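/- **DCOPs.** A DCOP $\mathcal M$ consists of finite sets of variables $X$ (totally ordered), constraints $F$ and agents $A$, a finite domain $D_x$ for each $x\in X$, for each $f\in F$ a scope $scp(f)\subseteq X$ and a utility function $f:\prod_{x\in scp(f)}D_x\to\mathbb R\cup\{-\infty\}$, and an owner map $\alpha:X\to A$. A *solution* is a complete assignment that maximizes $\sum_{f\in F} f(\mathbf x|_{scp(f)})$ over all complete assignments $\mathbf x\in\prod_x D_x$. The *constraint graph* on $A$ joins two distinct agents that own variables of the scope of a common constraint. Assume that the constraint graph is connected, every scope is nonempty, and every variable is in the scope of some constraint. **The algorithm ASP-DPOP.** Fix an arbitrary agent as the root. Answer sets are those of ground answer set programs with choice rules, $\#max$ aggregates and cardinality atoms; a rule with variables stands for all its ground instances; $\#\mathit{inf}$ stands for $-\infty$. *Phase 1.* Starting with the root, the agents perform a depth-first search of the constraint graph. The agent $a$ that holds the *tree* message, which carries the set of visited agents, chooses any unvisited neighbor $b$, which becomes its child, and sends it the message; $b$ records its parent $a$ and, as its pseudo-parents, all visited neighbors other than $a$. If $a$ has no unvisited neighbor, it returns the message to its parent and has completed Phase 1. In the tree obtained, let $C_a$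 be the set of children of $a$, let $sep_a$ be the set of variables owned by proper ancestors of $a$ that share a constraint with a variable owned by $a$ or by a descendant of $a$, and let $R_a$ be the set of constraints whose scope contains a variable of $a$ and otherwise only variables of $a$, its parent or its pseudo-parents. Let $\Pi_a$ be the set of facts describing the agent $a$, its neighbors, its parent, pseudo-parents and children, their variables, the constraints $f$ whose scope contains a variable of $a$ (with a fact $f(u,\bar v)$ for each tuple $\bar v$ of values, where $u$ is its utility, and $\#\mathit{inf}$ if the utility is $-\infty$), and the variables in these scopes with facts $value(x,d)$, $d\in D_x$. *Phase 2.* When $a$ has completed Phase 1 and received the UTIL messages $M_c$ of all children $c\in C_a$, it takes an answer set of $\Pi_a\cup I_a\cup\bigcup_{c\in C_a}M_c$, where $I_a$ consists of - $table\_row_a(U,\bar X_{sep_a})\leftarrow f(V_f,\bar X_{scp(f)})\ (f\in R_a),\ V_f\neq\#\mathit{inf}\ (f\in R_a),\ table\_max_c(U_c,\bar X_{sep_c})\ (c\in C_a),\ U=\sum_{f\in R_a}V_f+\sum_{c\in C_a}U_c$; - $table\_max_a(U,\bar X_{sep_a})\leftarrow value(x,X_x)\ (x\in sep_a),\ table\_row_a(\_,\bar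 X_{sep_a}),\ U=\#max\{V: table\_row_a(V,\bar X_{sep_a})\}$; - for $x\in sep_a$, the fact $table\_info(a,\alpha(x),x,\min D_x,\max D_x)$ and the facts $value(x,d)$, $d\in D_x$. It stores the atoms $table\_max_a$ and $table\_info(a,\ldots)$ of the answer set as $M_a$ and sends them to its parent. *Phase 3.* When $a$ has completed Phase 2 and, unless it is the root, received the VALUE message $M'$ of its parent ($M'=\emptyset$ for the root), it takes an answer set of $\Pi_a\cup M_a\cup I'_a\cup M'\cup\bigcup_{c\in C_a}M_c$, where, with $\alpha_a$ the set of variables owned by $a$, $I'_a$ consists of - $\{row(U,\bar X_{\alpha_a})\}\leftarrow solution(\alpha(x),x,X_x)\ (x\in sep_a),\ table\_max_a(U,\bar X_{sep_a}),\ f(V_f,\bar X_{scp(f)})\ (f\in R_a),\ table\_max_c(U_c,\bar X_{sep_c})\ (c\in C_a),\ U=\sum_{f\in R_a} V_f+\sum_{c\in C_a} U_c$; - $\leftarrow not\ 1\{row(U,\bar X_{\alpha_a})\}1$; - $solution(a,x,X_x)\leftarrow row(U,\bar X_{\alpha_a})$ for $x\in\alpha_a$. It sends the $solution$ atoms of the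 answer set to its children as its VALUE message. The run is *complete* when all agents have done this; its *result* is the assignment $\mathbf x$ if, for every $x$, the atom $solution(\alpha(x),x,v)$ is in the answer set found by $\alpha(x)$ exactly for $v=\mathbf x(x)$. The choices of neighbors and answer sets and the order of independent steps are arbitrary. **Proposition.** ASP-DPOP is sound and complete in solving DCOPs. Precisely, for each choice of the root: 1. There is no infinite run. Whenever Phase 1 has ended, the tree is a pseudo-tree of $\mathcal M$: its edges are edges of the constraint graph and form a tree with the given root that spans all agents, and any two adjacent agents of the constraint graph lie in the same branch. 2. If some complete assignment has a finite total utility, then no run gets stuck: in each reachable state that is not complete some step is possible. 3. (Soundness) Every complete run has a result, which is a solution of $\mathcal M$ with a finite total utility. (So no run is completed if all complete assignments have total utility $-\infty$.) 4. (Completeness) Let $\mathbf x$ be a solution with a finite total utility. Then each run in which no agent has sent a VALUE message yet, whatever pseudo-tree it generates, can be continued to a complete run with result $\mathbf x$. -/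

import Mathlib

/-! ## Ground answer set programs

Ground programs with facts, normal rules, integrity constraints, choice rules, `#max` aggregates and
cardinality atoms. A rule with variables stands for the set of its ground instances, so a program is
a (possibly infinite) set of ground rules. Classical negation is not needed. -/

namespace ASP

/-- Elements of the body of a ground rule over the atoms `α`. -/
inductive BodyLit (α : Type*) where
  /-- an atom `a` -/
  | pos (a : α)
  /-- negation as failure `not a` -/
  | naf (a : α)
  /-- the aggregate `u = #max{v : a | (v, a) ∈ E}`, where `⊥` is the constant `#inf` -/
  | isMax (u : WithBot ℝ) (E : Set (WithBot ℝ × α))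
  /-- the cardinality atom `l {C} u` -/
  | card (l : ℕ∞) (C : Set α) (u : ℕ∞)
  /-- the negated cardinality atom `not l {C} u` -/
  | nafCard (l : ℕ∞) (C : Set α) (u : ℕ∞)

/-- Heads of rules: an atom, empty (integrity constraint), or a choice `l {C} u`. -/
inductive Head (α : Type*) where
  | atom (a : α)
  | empty
  | choice (l : ℕ∞) (C : Set α) (u : ℕ∞)

structure Rule (α : Type*) where
  head : Head α
  body : Set (BodyLit α)

abbrev Program (α : Type*) := Set (Rule α)

/-- The value of `#max` over the elements of `E` whose condition is in `S` is `u`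
(over no element at all it is `#inf`). -/
def MaxEq {α : Type*} (u : WithBot ℝ) (E : Set (WithBot ℝ × α)) (S : Set α) : Prop :=
  IsGreatest (insert ⊥ {v | ∃ a ∈ S, (v, a) ∈ E}) u

def CardIn {α : Type*} (l : ℕ∞) (C : Set α) (u : ℕ∞) (S : Set α) : Prop :=
  l ≤ (C ∩ S).encard ∧ (C ∩ S).encard ≤ u

/-- `S` satisfies a body element. -/
def BodyLit.Holds {α : Type*} (S : Set α) : BodyLit α → Prop
  | .pos a => a ∈ S
  | .naf a => a ∉ S
  | .isMax u E => MaxEq u E S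
  | .card l C u => CardIn l C u S
  | .nafCard l C u => ¬ CardIn l C u S

/-- `T` satisfies what remains of a body element in the reduct with respect to `S`: negation as
failure is evaluated in `S`; a rule with an aggregate that fails in `S` is deleted, and otherwise the
aggregate is kept. -/
def BodyLit.RedHolds {α : Type*} (S T : Set α) : BodyLit α → Prop
  | .pos a => a ∈ T
  | .naf a => a ∉ S
  | .isMax u E => MaxEq u E S ∧ MaxEq u E T
  | .card l C u => CardIn l C u S ∧ CardIn l C u T
  | .nafCard l C u => ¬ CardIn l C u S

/-- `S` satisfies the head of a rule. -/
def Head.Holds {α : Type*} (S : Set α) : Head α → Prop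
  | .atom a => a ∈ S
  | .empty => False
  | .choice l C u => CardIn l C u S

/-- `T` satisfies the head of a rule in the reduct with respect to `S`; a choice over `C` is replaced
by one rule for each element of `C` that was chosen in `S`. -/
def Head.RedHolds {α : Type*} (S T : Set α) : Head α → Prop
  | .atom a => a ∈ T
  | .empty => False
  | .choice _ C _ => C ∩ S ⊆ T

/-- `S` satisfies all rules of `P`. -/
def Satisfies {α : Type*} (P : Program α) (S : Set α) : Prop :=
  ∀ r ∈ P, (∀ b ∈ r.body, b.Holds S) → r.head.Holds S

/-- `T` satisfies all rules of the reduct of `P` with respect to `S`. -/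
def SatisfiesReduct {α : Type*} (P : Program α) (S T : Set α) : Prop :=
  ∀ r ∈ P, (∀ b ∈ r.body, b.RedHolds S T) → r.head.RedHolds S T

/-- `S` is an answer set (stable model) of `P`: it satisfies `P` and no proper subset of it satisfies
the reduct of `P` with respect to `S`. -/
def IsAnswerSet {α : Type*} (P : Program α) (S : Set α) : Prop :=
  Satisfies P S ∧ ∀ T ⊆ S, SatisfiesReduct P S T → T = S

/-- The facts `a ←` for `a ∈ s`. -/
def facts {α : Type*} (s : Set α) : Program α :=
  {r | ∃ a ∈ s, r = ⟨.atom a, ∅⟩}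

end ASP

/-! ## Distributed constraint optimization problems -/

/-- A DCOP with variables `X`, constraints `F`, agents `A` and values in `V`. The variables in scopes
are listed in the order of `X`; the utility `-∞` is `⊥`. -/
structure DCOP (X F A V : Type*) where
  dom : X → Finset V
  scope : F → Finset X
  utility : (f : F) → ((x : {x // x ∈ scope f}) → {v // v ∈ dom x.1}) → WithBot ℝ
  owner : X → A

namespace DCOP

variable {X F A V : Type*}

/-- Complete value assignments. -/
abbrev Assignment (M : DCOP X F A V) := (x : X) → {v // v ∈ M.dom x}

/-- The sum of the utilities of all constraints. -/
noncomputable def total [Fintype F] (M : DCOP X F A V) (s : M.Assignment) : WithBot ℝ :=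
  ∑ f, M.utility f (fun x => s x.1)

/-- The solutions of `M`: the complete assignments that maximize the total utility. -/
def IsSolution [Fintype F] (M : DCOP X F A V) (s : M.Assignment) : Prop :=
  ∀ t : M.Assignment, M.total t ≤ M.total s

/-- The constraint graph. -/
def graph (M : DCOP X F A V) : SimpleGraph A where
  Adj a b := a ≠ b ∧ ∃ f, ∃ x ∈ M.scope f, ∃ y ∈ M.scope f, M.owner x = a ∧ M.owner y = b
  symm := ⟨fun _ _ ⟨hne, f, x, hx, y, hy, ha, hb⟩ => ⟨hne.symm, f, y, hy, x, hx, hb, ha⟩⟩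
  loopless := ⟨fun _ h => h.1 rfl⟩

end DCOP

/-! ## The tree built by the agents -/

/-- What the agents record in Phase 1: the parent (`none` for the root and for agents that are not
visited yet) and the pseudo-parents. -/
structure TreeData (A : Type*) where
  parent : A → Option A
  pseudo : A → Finset A

namespace TreeData

variable {A : Type*}

/-- `T.Anc b a`: the agent `b` is a (proper) ancestor of the agent `a`. -/
def Anc (T : TreeData A) (b a : A) : Prop :=
  Relation.TransGen (fun u v => T.parent u = some v) a b

open scoped Classical in
noncomputable def children [Fintype A] (T : TreeData A) (a : A) : Finset A :=
  Finset.univ.filter fun b => T.parent b = some a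

/-- The tree edges are edges of the constraint graph and form a tree with the given root that spans
all agents, and agents that are adjacent in the constraint graph lie in the same branch. -/
def IsPseudoTree {X F V : Type*} (M : DCOP X F A V) (T : TreeData A) (root : A) : Prop :=
  T.parent root = none ∧
  (∀ a p, T.parent a = some p → M.graph.Adj a p) ∧
  (∀ a, a ≠ root → T.Anc root a) ∧
  ∀ a b, M.graph.Adj a b → T.Anc a b ∨ T.Anc b a

end TreeData

/-! ## The programs of the agents -/

namespace ASPDPOP

/-- The ground atoms of the programs of the agents. Utilities are terms in `ℝ ∪ {#inf}`. -/
inductive Atom (X F A V : Type*) where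
  | agent (a : A)
  | owner (a : A) (x : X)
  | neighbor (a : A)
  /-- `parent none` is `parent(master)` -/
  | parent (p : Option A)
  | pseudoParent (a : A)
  | children (a : A)
  | var (x : X)
  | value (x : X) (v : V)
  | constraint (f : F)
  | scope (f : F) (x : X)
  /-- `f(u, v₁, …, vₖ)` -/
  | util (f : F) (u : WithBot ℝ) (args : List V)
  /-- `table_row_a(u, v₁, …, vₖ)` -/
  | tableRow (a : A) (u : WithBot ℝ) (args : List V)
  /-- `table_max_a(u, v₁, …, vₖ)` -/
  | tableMax (a : A) (u : WithBot ℝ) (args : List V)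
  /-- `table_info(a, b, x, lb, ub)` -/
  | tableInfo (a b : A) (x : X) (lb : WithTop V) (ub : WithBot V)
  | row (u : WithBot ℝ) (args : List V)
  | solution (a : A) (x : X) (v : V)

open ASP

variable {X F A V : Type*}

/-- The values of the variables in `s` under a substitution, in the order of the variables. -/
def args [LinearOrder X] (s : Finset X) (σ : X → V) : List V :=
  (s.sort (· ≤ ·)).map σ

section Local

variable (M : DCOP X F A V) (T : TreeData A)

open scoped Classical in
/-- The variables owned by `a`. -/
noncomputable def owned [Fintype X] (a : A) : Finset X :=
  Finset.univ.filter fun x => M.owner x = a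

open scoped Classical in
/-- The separator of `a`: the variables of ancestors of `a` that share a constraint with a variable of
`a` or of a descendant of `a`. -/
noncomputable def sep [Fintype X] (a : A) : Finset X :=
  Finset.univ.filter fun x => T.Anc (M.owner x) a ∧
    ∃ y f, (M.owner y = a ∨ T.Anc a (M.owner y)) ∧ x ∈ M.scope f ∧ y ∈ M.scope f

open scoped Classical in
/-- The constraints related to `a`: those with a variable of `a` in the scope and all other variables
of the scope owned by `a`, its parent or its pseudo-parents. -/
noncomputable def related [Fintype F] (a : A) : Finset F :=
  Finset.univ.filter fun f =>
    (∀ x ∈ M.scope f, M.owner x = a ∨ T.parent a = some (M.owner x) ∨ M.owner x ∈ T.pseudo a) ∧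
    ∃ x ∈ M.scope f, M.owner x = a

/-- The facts `L(x)` that describe a variable. -/
def varFacts (x : X) : Set (Atom X F A V) :=
  {.var x} ∪ {m | ∃ v ∈ M.dom x, m = .value x v}

/-- The facts `L(f)` that describe a constraint (with the utility `#inf` for `-∞`). -/
def conFacts [LinearOrder X] (f : F) : Set (Atom X F A V) :=
  {.constraint f} ∪ {m | ∃ x ∈ M.scope f, m = .scope f x} ∪
  {m | ∃ (σ : X → V) (h : ∀ x ∈ M.scope f, σ x ∈ M.dom x),
    m = .util f (M.utility f (fun x => ⟨σ x.1, h x.1 x.2⟩)) (args (M.scope f) σ)}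

/-- A constraint is owned by each agent that owns a variable of its scope. -/
def OwnsCon (a : A) (f : F) : Prop := ∃ x ∈ M.scope f, M.owner x = a

/-- The facts of the specification module of `a`, with those added in Phase 1. -/
noncomputable def spec [LinearOrder X] [Fintype A] (a : A) : Set (Atom X F A V) :=
  {.agent a} ∪
  {m | ∃ x, M.owner x = a ∧ m = .owner a x} ∪
  {m | ∃ b, M.graph.Adj a b ∧ m = .neighbor b} ∪
  {m | ∃ x, M.graph.Adj a (M.owner x) ∧ m = .owner (M.owner x) x} ∪
  {m | ∃ f, OwnsCon M a f ∧ m ∈ conFacts M f} ∪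
  {m | ∃ f, OwnsCon M a f ∧ ∃ x ∈ M.scope f, m ∈ varFacts M x} ∪
  {.parent (T.parent a)} ∪
  {m | ∃ b ∈ T.pseudo a, m = .pseudoParent b} ∪
  {m | ∃ b ∈ T.children a, m = .children b}

variable [Fintype X] [LinearOrder X] [Fintype F] [Fintype A] [LinearOrder V]

/-- The part `f₁(V₁, …), …, table_max_c₁(U₁, …), …` common to the bodies of the rules that join the
related constraints and the tables of the children, under the substitution `σ, v, u`. -/
def joinBody (a : A) (σ : X → V) (v : F → WithBot ℝ) (u : A → WithBot ℝ) :
    Set (BodyLit (Atom X F A V)) :=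
  {b | ∃ f ∈ related M T a, b = .pos (.util f (v f) (args (M.scope f) σ))} ∪
  {b | ∃ c ∈ T.children a, b = .pos (.tableMax c (u c) (args (sep M T c) σ))}

/-- The sum `V₁ + … + U₁ + …` over the related constraints and the children. -/
noncomputable def joinSum (a : A) (v : F → WithBot ℝ) (u : A → WithBot ℝ) : WithBot ℝ :=
  ∑ f ∈ related M T a, v f + ∑ c ∈ T.children a, u c

/-- The rules generated by `a` in Phase 2: the ground instances of the rule for `table_row_a`
and of the rule for `table_max_a`, the facts `table_info`, and the facts `value` for the separator
variables, whose domains are known to `a` from its specification or from the `table_info` facts it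
received. -/
def utilRules (a : A) : Program (Atom X F A V) :=
  {r | ∃ (σ : X → V) (v : F → WithBot ℝ) (u : A → WithBot ℝ) (U : WithBot ℝ),
    (∀ f ∈ related M T a, v f ≠ ⊥) ∧ U = joinSum M T a v u ∧
    r = ⟨.atom (.tableRow a U (args (sep M T a) σ)), joinBody M T a σ v u⟩} ∪
  {r | ∃ (σ : X → V) (U W : WithBot ℝ),
    r = ⟨.atom (.tableMax a U (args (sep M T a) σ)),
      {b | ∃ x ∈ sep M T a, b = .pos (.value x (σ x))} ∪
      {.pos (.tableRow a W (args (sep M T a) σ)),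
        .isMax U {p | p.2 = .tableRow a p.1 (args (sep M T a) σ)}}⟩} ∪
  facts {m | ∃ x ∈ sep M T a, m = .tableInfo a (M.owner x) x (M.dom x).min (M.dom x).max} ∪
  facts {m | ∃ x ∈ sep M T a, ∃ v ∈ M.dom x, m = .value x v}

/-- The rules generated by `a` in Phase 3: the ground instances of the choice rule for `row`, of the
constraint `← not 1 {row(…)} 1`, and of the rules for `solution`. -/
def valueRules (a : A) : Program (Atom X F A V) :=
  {r | ∃ (σ : X → V) (v : F → WithBot ℝ) (u : A → WithBot ℝ) (U : WithBot ℝ),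
    U = joinSum M T a v u ∧
    r = ⟨.choice 0 {.row U (args (owned M a) σ)} ⊤,
      {b | ∃ x ∈ sep M T a, b = .pos (.solution (M.owner x) x (σ x))} ∪
      {.pos (.tableMax a U (args (sep M T a) σ))} ∪ joinBody M T a σ v u⟩} ∪
  {⟨.empty, {.nafCard 1 {m | ∃ (U : WithBot ℝ) (σ : X → V), m = .row U (args (owned M a) σ)} 1}⟩} ∪
  {r | ∃ (σ : X → V) (U : WithBot ℝ), ∃ x ∈ owned M a,
    r = ⟨.atom (.solution a x (σ x)), {.pos (.row U (args (owned M a) σ))}⟩}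

end Local

/-! ## Runs of the algorithm -/

/-- A global state of the agents and the messages. -/
structure Config (X F A V : Type*) where
  /-- the agent that currently performs the depth-first search (holds the `tree` message);
  `none` once the root is through -/
  token : Option A
  /-- the set of visited agents, carried by the `tree` messages -/
  visited : Finset A
  /-- the agents that have completed Phase 1 -/
  finished : Finset A
  /-- the parents and pseudo-parents recorded so far -/
  tree : TreeData A
  /-- the encoded UTIL message computed, stored and sent to its parent by each agent, if any so far -/
  util : A → Option (Set (Atom X F A V))
  /-- the encoded VALUE message computed and sent to its children by each agent, if any so far -/
  value : A → Option (Set (Atom X F A V))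

/-- The state in which the agent `root` has been selected as the root and starts the search. -/
def initial (X F V : Type*) {A : Type*} (root : A) : Config X F A V where
  token := some root
  visited := {root}
  finished := ∅
  tree := ⟨fun _ => none, fun _ => ∅⟩
  util := fun _ => none
  value := fun _ => none

/-- The UTIL message that `a` extracts from an answer set. -/
def utilAnswer (a : A) (S : Set (Atom X F A V)) : Set (Atom X F A V) :=
  {m ∈ S | (∃ u l, m = .tableMax a u l) ∨ ∃ b x lb ub, m = .tableInfo a b x lb ub}

/-- The VALUE message that an agent extracts from an answer set. -/
def valueAnswer (S : Set (Atom X F A V)) : Set (Atom X F A V) :=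
  {m ∈ S | ∃ b x v, m = .solution b x v}

namespace Config

/-- The run is complete: every agent has solved its VALUE program. -/
def Complete (c : Config X F A V) : Prop := ∀ a, c.value a ≠ none

/-- The values that the agents have found for their own variables form the assignment `s`: the atom
`solution(a, x, v)` is in the answer set found by the owner `a` of `x` exactly for `v = s x`. -/
def Result (M : DCOP X F A V) (c : Config X F A V) (s : M.Assignment) : Prop :=
  ∀ x v, (∃ N, c.value (M.owner x) = some N ∧ .solution (M.owner x) x v ∈ N) ↔ v = (s x : V)

variable [Fintype A]

/-- The UTIL messages that `a` has received from its children. -/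
def receivedUtil (c : Config X F A V) (a : A) : Set (Atom X F A V) :=
  {m | ∃ b ∈ c.tree.children a, ∃ N, c.util b = some N ∧ m ∈ N}

/-- The UTIL message that `a` has stored itself. -/
def storedUtil (c : Config X F A V) (a : A) : Set (Atom X F A V) :=
  {m | ∃ N, c.util a = some N ∧ m ∈ N}

/-- The VALUE message that `a` has received from its parent (nothing for the root). -/
def receivedValue (c : Config X F A V) (a : A) : Set (Atom X F A V) :=
  {m | ∃ p, c.tree.parent a = some p ∧ ∃ N, c.value p = some N ∧ m ∈ N}

variable [Fintype X] [LinearOrder X] [Fintype F] [LinearOrder V]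

/-- The program that `a` solves in Phase 2. -/
def utilProgram (M : DCOP X F A V) (c : Config X F A V) (a : A) : Program (Atom X F A V) :=
  facts (spec M c.tree a) ∪ utilRules M c.tree a ∪ facts (c.receivedUtil a)

/-- The program that `a` solves in Phase 3. -/
def valueProgram (M : DCOP X F A V) (c : Config X F A V) (a : A) : Program (Atom X F A V) :=
  facts (spec M c.tree a) ∪ facts (c.storedUtil a) ∪ valueRules M c.tree a ∪
    facts (c.receivedValue a) ∪ facts (c.receivedUtil a)

variable [DecidableEq A]

open scoped Classical in
/-- One step of the algorithm. The order of independent steps, the choice of the next agent in the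
search and the choice of the answer sets are arbitrary. -/
inductive Step (M : DCOP X F A V) : Config X F A V → Config X F A V → Prop where
  /-- Phase 1: the searching agent `a` makes an unvisited neighbor `b` its child and sends it the
  `tree` message; `b` records its parent and pseudo-parents and continues the search. -/
  | visit (c : Config X F A V) (a b : A) (ht : c.token = some a) (hab : M.graph.Adj a b)
      (hb : b ∉ c.visited) :
      Step M c { c with
        token := some b
        visited := insert b c.visited
        tree :=
          { parent := Function.update c.tree.parent b (some a)
            pseudo := Function.update c.tree.pseudo b
              (c.visited.filter fun d => M.graph.Adj b d ∧ d ≠ a) } }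
  /-- Phase 1: the searching agent `a` has no unvisited neighbor, and returns the `tree` message to
  its parent. -/
  | back (c : Config X F A V) (a : A) (ht : c.token = some a)
      (hn : ∀ b, M.graph.Adj a b → b ∈ c.visited) :
      Step M c { c with
        token := c.tree.parent a
        finished := insert a c.finished }
  /-- Phase 2: the agent `a`, having completed Phase 1 and received the UTIL messages of all of its
  children, solves its UTIL program and sends its UTIL message. -/
  | util (c : Config X F A V) (a : A) (S : Set (Atom X F A V)) (hf : a ∈ c.finished)
      (hu : c.util a = none) (hc : ∀ b ∈ c.tree.children a, c.util b ≠ none)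
      (hS : IsAnswerSet (c.utilProgram M a) S) :
      Step M c { c with util := Function.update c.util a (some (utilAnswer a S)) }
  /-- Phase 3: the agent `a`, having completed Phase 2 and, unless it is the root, received the VALUE
  message of its parent, solves its VALUE program and sends its VALUE message. -/
  | value (c : Config X F A V) (a : A) (S : Set (Atom X F A V)) (hu : c.util a ≠ none)
      (hv : c.value a = none) (hp : ∀ p, c.tree.parent a = some p → c.value p ≠ none)
      (hS : IsAnswerSet (c.valueProgram M a) S) :
      Step M c { c with value := Function.update c.value a (some (valueAnswer S)) }

/-- `c'` can be reached from `c` in finitely many steps. -/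
def Reaches (M : DCOP X F A V) (c c' : Config X F A V) : Prop :=
  Relation.ReflTransGen (Step M) c c'

end Config

end ASPDPOP

/-! The algorithm is dynamic programming along a pseudo-tree. It has to be shown that answer sets
compute the recursion exactly, and that this survives every interleaving of the steps.

Tree. During the search, the visited agents that are not through form the path from the token to the
root (`IsSearch`). A newly visited agent has no neighbor that is through, so its visited neighbors
are its ancestors (`visit_step`), and adjacent visited agents always lie in one branch. The owners
of the variables in a scope are pairwise equal or adjacent, so they form a chain, and each
constraint is related to exactly one agent, the lowest of these owners
(`mem_subConstraints_of_comparable`, `related_unique`).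

Recursion. `optUtility` is the best utility of the constraints in a subtree as a function of the
values on the separator. The subtrees of the children are disjoint and meet the rest only in
separators, so the optima of the children are reached simultaneously. This gives the Bellman
equation (`joinUtility_le_optUtility`, `exists_joinUtility_eq`). Local optimality at all agents adds
up to global optimality (`subtreeUtility_eq_optUtility`), and a finite global optimum is optimal in
every subtree (`subtreeUtility_eq_optUtility_child`).

Programs. The UTIL program is stratified, and its table lists exactly the finite values of
`optUtility` (`tableMax_mem_iff`). The answer sets of the VALUE program yield precisely the locally
optimal choices (`exists_of_valueAnswerSet`, `exists_isAnswerSet_value`).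

Runs. Phase 2 may overlap Phase 1, but the subtree of an agent that is through no longer changes, so
its table stays correct. Phase 3 starts only when the search is over. Every step raises a bounded
counter, which excludes infinite runs; while a finite optimum exists some step is always possible,
and the VALUE steps can be made to follow any prescribed solution of finite utility. -/

/-! ### Stable models: supportedness and stratified derivations -/

namespace ASP

variable {α : Type*}

/-- The rule `r` can derive the atom `m`. -/
def Head.Derives (h : Head α) (m : α) : Prop :=
  h = .atom m ∨ ∃ l C u, h = .choice l C u ∧ m ∈ C

theorem BodyLit.RedHolds.holds {S T : Set α} (hTS : T ⊆ S) {b : BodyLit α}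
    (h : b.RedHolds S T) : b.Holds S := by
  cases b with
  | pos a => exact hTS h
  | naf a => exact h
  | isMax u E => exact h.1
  | card l C u => exact h.1
  | nafCard l C u => exact h

/-- Every atom of an answer set is derived by a rule whose body holds. -/
theorem IsAnswerSet.supported {P : Program α} {S : Set α} (h : IsAnswerSet P S) {m : α}
    (hm : m ∈ S) : ∃ r ∈ P, (∀ b ∈ r.body, b.Holds S) ∧ r.head.Derives m := by
  by_contra! hcon
  -- If no applicable rule derives `m`, then `S` without `m` still satisfies the reduct, against
  -- minimality.
  have hT : S \ {m} = S := by
    refine h.2 _ Set.sdiff_subset fun r hr hb => ?_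
    have hbS : ∀ b ∈ r.body, b.Holds S := fun b hb' => (hb b hb').holds Set.sdiff_subset
    have hh := h.1 r hr hbS
    have hn := hcon r hr hbS
    rcases hd : r.head with a | _ | ⟨l, C, u⟩
    · rw [hd] at hh hn
      refine ⟨hh, fun ham => hn (Or.inl ?_)⟩
      rw [Set.mem_singleton_iff.1 ham]
    · rw [hd] at hh
      exact hh
    · rw [hd] at hn
      rintro x ⟨hxC, hxS⟩
      refine ⟨hxS, fun hxm => hn (Or.inr ⟨l, C, u, rfl, ?_⟩)⟩
      rwa [← Set.mem_singleton_iff.1 hxm]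
  exact (hT.symm ▸ hm : m ∈ S \ {m}).2 rfl

/-- A model whose atoms are derived by rules whose bodies only depend on atoms of lower levels is an
answer set. -/
theorem isAnswerSet_of_level {P : Program α} {S : Set α} (hS : Satisfies P S) (level : α → ℕ)
    (h : ∀ m ∈ S, ∃ r ∈ P, r.head.Derives m ∧ ∀ T ⊆ S,
      (∀ m' ∈ S, level m' < level m → m' ∈ T) → ∀ b ∈ r.body, b.RedHolds S T) :
    IsAnswerSet P S := by
  refine ⟨hS, fun T hTS hT => hTS.antisymm ?_⟩
  have key : ∀ n, ∀ m ∈ S, level m = n → m ∈ T := by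
    intro n
    induction n using Nat.strong_induction_on with
    | _ n ih =>
      rintro m hm rfl
      obtain ⟨r, hr, hd, hb⟩ := h m hm
      have hh := hT r hr (hb T hTS fun m' hm' hl => ih _ hl m' hm' rfl)
      rcases hd with hd | ⟨l, C, u, hd, hmC⟩
      · rw [hd] at hh
        exact hh
      · rw [hd] at hh
        exact hh ⟨hmC, hm⟩
  exact fun m hm => key _ m hm rfl

theorem IsAnswerSet.mem_of_fact {P : Program α} {S s : Set α} (h : IsAnswerSet P S)
    (hs : facts s ⊆ P) {m : α} (hm : m ∈ s) : m ∈ S :=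
  h.1 ⟨.atom m, ∅⟩ (hs ⟨m, hm, rfl⟩) (by simp)

end ASP

/-! ### Finite sums of utilities in `ℝ ∪ {-∞}` -/

namespace WithBot

variable {ι : Type*}

theorem sum_ne_bot_iff {s : Finset ι} {f : ι → WithBot ℝ} :
    ∑ i ∈ s, f i ≠ ⊥ ↔ ∀ i ∈ s, f i ≠ ⊥ := by
  classical
  induction s using Finset.induction_on with
  | empty => simp
  | insert a s ha ih =>
    rw [Finset.sum_insert ha, Ne, WithBot.add_eq_bot, not_or, Finset.forall_mem_insert]
    exact and_congr Iff.rfl ih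

/-- Finiteness makes all terms real, so `r` cancels, and termwise inequalities whose sums agree are
equalities. Without `hr` this fails, since `⊥` absorbs everything. -/
theorem eq_of_sum_le_of_ne_bot {s : Finset ι} {f g : ι → WithBot ℝ} {r : WithBot ℝ}
    (hfg : ∀ i ∈ s, f i ≤ g i) (hr : r + ∑ i ∈ s, f i ≠ ⊥)
    (h : r + ∑ i ∈ s, g i ≤ r + ∑ i ∈ s, f i) : ∀ i ∈ s, f i = g i := by
  rw [Ne, WithBot.add_eq_bot, not_or] at hr
  have hf := sum_ne_bot_iff.1 hr.2
  have hg : ∀ i ∈ s, g i ≠ ⊥ := fun i hi h => hf i hi (le_bot_iff.1 (h ▸ hfg i hi))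
  lift r to ℝ using hr.1
  -- All terms are finite, so the default value `0` of `unbotD` is never taken.
  have ef : ∑ i ∈ s, f i = ((∑ i ∈ s, (f i).unbotD 0 : ℝ) : WithBot ℝ) := by
    rw [WithBot.coe_sum]
    refine Finset.sum_congr rfl fun i hi => ?_
    obtain ⟨y, hy⟩ := WithBot.ne_bot_iff_exists.1 (hf i hi)
    simp [← hy]
  have eg : ∑ i ∈ s, g i = ((∑ i ∈ s, (g i).unbotD 0 : ℝ) : WithBot ℝ) := by
    rw [WithBot.coe_sum]
    refine Finset.sum_congr rfl fun i hi => ?_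
    obtain ⟨y, hy⟩ := WithBot.ne_bot_iff_exists.1 (hg i hi)
    simp [← hy]
  have hle : ∀ i ∈ s, (f i).unbotD 0 ≤ (g i).unbotD 0 := by
    intro i hi
    obtain ⟨y, hy⟩ := WithBot.ne_bot_iff_exists.1 (hf i hi)
    obtain ⟨z, hz⟩ := WithBot.ne_bot_iff_exists.1 (hg i hi)
    have := hfg i hi
    rw [← hy, ← hz] at this ⊢
    simpa using this
  rw [ef, eg, ← WithBot.coe_add, ← WithBot.coe_add, WithBot.coe_le_coe] at h
  have heq := (Finset.sum_eq_sum_iff_of_le hle).1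
    (le_antisymm (Finset.sum_le_sum hle) (by linarith))
  intro i hi
  have := heq i hi
  obtain ⟨y, hy⟩ := WithBot.ne_bot_iff_exists.1 (hf i hi)
  obtain ⟨z, hz⟩ := WithBot.ne_bot_iff_exists.1 (hg i hi)
  rw [← hy, ← hz] at this ⊢
  simpa using this

end WithBot

theorem ASPDPOP.args_eq_args_iff {X V : Type*} [LinearOrder X] {s : Finset X} {σ τ : X → V} :
    args s σ = args s τ ↔ ∀ x ∈ s, σ x = τ x := by
  simp [args, List.map_inj_left]

/-! ### Ancestors and descendants -/

namespace TreeData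

variable {X F A V : Type*} {M : DCOP X F A V} {T : TreeData A}

/-- The agent `b` is `a` or a descendant of `a`. -/
def Below (T : TreeData A) (b a : A) : Prop :=
  Relation.ReflTransGen (fun u v => T.parent u = some v) b a

theorem below_iff {a b : A} : T.Below b a ↔ b = a ∨ T.Anc a b := by
  rw [Below, Relation.reflTransGen_iff_eq_or_transGen, eq_comm, Anc]

theorem Below.refl (a : A) : T.Below a a := Relation.ReflTransGen.refl

theorem Below.trans {a b c : A} (h : T.Below a b) (h' : T.Below b c) : T.Below a c :=
  Relation.ReflTransGen.trans h h'

theorem Anc.below {a b : A} (h : T.Anc a b) : T.Below b a := Relation.TransGen.to_reflTransGen h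

theorem Anc.of_below {a b c : A} (h : T.Anc a b) (h' : T.Below c b) : T.Anc a c :=
  Relation.TransGen.trans_right h' h

theorem anc_of_parent {a p : A} (h : T.parent a = some p) : T.Anc p a := Relation.TransGen.single h

/-- Parents are unique, so the agents above `a` form a chain. -/
theorem below_total {a b c : A} (hb : T.Below a b) (hc : T.Below a c) :
    T.Below b c ∨ T.Below c b :=
  Relation.ReflTransGen.total_of_right_unique
    (fun _ _ _ h h' => Option.some_injective _ (h.symm.trans h')) hb hc

theorem anc_iff_parent {a b : A} : T.Anc b a ↔ ∃ p, T.parent a = some p ∧ T.Below p b := by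
  exact Relation.TransGen.head'_iff

theorem anc_iff_child {a b : A} : T.Anc a b ↔ ∃ c, T.parent c = some a ∧ T.Below b c := by
  rw [Anc, Relation.TransGen.tail'_iff]
  exact exists_congr fun c => and_comm

theorem mem_children [Fintype A] {a b : A} : b ∈ T.children a ↔ T.parent b = some a := by
  simp [children]

/-- A possibly partial tree in which parents and pseudo-parents are the adjacent ancestors. -/
structure IsDFSForest (M : DCOP X F A V) (T : TreeData A) : Prop where
  rank : ∃ r : A → ℕ, ∀ b p, T.parent b = some p → r p < r b
  back : ∀ b d, (T.parent b = some d ∨ d ∈ T.pseudo b) ↔ M.graph.Adj b d ∧ T.Anc d b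

theorem exists_rank_anc (h : ∃ r : A → ℕ, ∀ b p, T.parent b = some p → r p < r b) :
    ∃ r : A → ℕ, ∀ b a, T.Anc a b → r a < r b := by
  obtain ⟨r, hr⟩ := h
  refine ⟨r, fun b a h => ?_⟩
  induction h with
  | single h => exact hr _ _ h
  | tail _ h ih => exact (hr _ _ h).trans ih

namespace IsDFSForest

theorem irrefl (h : T.IsDFSForest M) (a : A) : ¬ T.Anc a a := by
  obtain ⟨r, hr⟩ := exists_rank_anc h.rank
  exact fun ha => lt_irrefl _ (hr _ _ ha)

theorem asymm (h : T.IsDFSForest M) {a b : A} (hab : T.Anc a b) : ¬ T.Below a b :=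
  fun hba => h.irrefl a (hab.of_below hba)

/-- Both children lie on the chain above `b`. If one were strictly below the other, its parent `a`
would lie below a child of `a`, against the rank. -/
theorem child_unique (h : T.IsDFSForest M) {a b c c' : A} (hc : T.parent c = some a)
    (hc' : T.parent c' = some a) (hb : T.Below b c) (hb' : T.Below b c') : c = c' := by
  have key : ∀ {c c'}, T.parent c = some a → T.parent c' = some a → T.Below c c' → c = c' := by
    intro c c' hc hc' hcc
    rcases below_iff.1 hcc with hcc | hcc
    · exact hcc
    · obtain ⟨p, hp, hpc⟩ := anc_iff_parent.1 hcc
      obtain rfl : a = p := Option.some_injective _ (hc.symm.trans hp)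
      exact (h.asymm (anc_of_parent hc') hpc).elim
  rcases below_total hb hb' with hcc | hcc
  · exact key hc hc' hcc
  · exact (key hc' hc hcc).symm

theorem adj_of_parent (h : T.IsDFSForest M) {b p : A} (hb : T.parent b = some p) :
    M.graph.Adj b p := ((h.back b p).1 (Or.inl hb)).1

end IsDFSForest

/-! ### Attaching a leaf, and the invariant of the depth-first search -/

section Update

variable {T T' : TreeData A} {a b : A}

/-- No parent pointer leads to `b`, so an upward path that starts elsewhere never uses the changed
pointer. -/
theorem anc_update_iff_of_ne [DecidableEq A]
    (hT' : T'.parent = Function.update T.parent b (some a))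
    (hleaf : ∀ c, T.parent c ≠ some b) {u v : A} (hv : v ≠ b) :
    T'.Anc u v ↔ T.Anc u v := by
  constructor
  · intro h
    have key : v ≠ b → Relation.TransGen (fun u v => T.parent u = some v) v u := by
      refine Relation.TransGen.head_induction_on (motive := fun v _ => v ≠ b →
        Relation.TransGen (fun u v => T.parent u = some v) v u) h ?_ ?_
      · intro w hw hne
        rw [hT', Function.update_of_ne hne] at hw
        exact .single hw
      · intro w x hw _ ih hne
        rw [hT', Function.update_of_ne hne] at hw
        exact .head hw (ih fun hx => hleaf w (hx ▸ hw))
    exact key hv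
  · intro h
    have key : v ≠ b → Relation.TransGen (fun u v => T'.parent u = some v) v u := by
      refine Relation.TransGen.head_induction_on (motive := fun v _ => v ≠ b →
        Relation.TransGen (fun u v => T'.parent u = some v) v u) h ?_ ?_
      · intro w hw hne
        refine .single ?_
        rw [hT', Function.update_of_ne hne]
        exact hw
      · intro w x hw _ ih hne
        refine .head ?_ (ih fun hx => hleaf w (hx ▸ hw))
        rw [hT', Function.update_of_ne hne]
        exact hw
    exact key hv

theorem anc_update_self_iff [DecidableEq A]
    (hT' : T'.parent = Function.update T.parent b (some a))
    (hleaf : ∀ c, T.parent c ≠ some b) (hab : a ≠ b) {u : A} :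
    T'.Anc u b ↔ T.Below a u := by
  rw [anc_iff_parent, below_iff]
  have : T'.parent b = some a := by rw [hT', Function.update_self]
  simp only [this, Option.some.injEq, exists_eq_left', below_iff,
    anc_update_iff_of_ne hT' hleaf hab]

end Update

/-- The invariant of the depth-first search: `W` is the set of visited agents, `D` the set of agents
that are through, and the others in `W` lie on the path from the token `t` to the root. -/
structure IsSearch (M : DCOP X F A V) (root : A) (T : TreeData A) (t : Option A)
    (W D : Finset A) : Prop extends T.IsDFSForest M where
  root_mem : root ∈ W
  parent_root : T.parent root = none
  mem_of_parent : ∀ b p, T.parent b = some p → b ∈ W ∧ p ∈ W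
  below_root : ∀ a ∈ W, T.Below a root
  comparable : ∀ a ∈ W, ∀ b ∈ W, M.graph.Adj a b → T.Anc a b ∨ T.Anc b a
  done_sub : D ⊆ W
  done_adj : ∀ a ∈ D, ∀ b, M.graph.Adj a b → b ∈ W
  token_mem : ∀ b, t = some b → b ∈ W
  active : ∀ a ∈ W, a ∉ D ↔ ∃ b, t = some b ∧ T.Below b a

namespace IsSearch

variable {root : A} {t : Option A} {W D : Finset A}

theorem mem_of_anc (h : T.IsSearch M root t W D) {a b : A} (hab : T.Anc a b) : a ∈ W ∧ b ∈ W := by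
  obtain ⟨p, hp, -⟩ := anc_iff_parent.1 hab
  obtain ⟨c, hc, -⟩ := anc_iff_child.1 hab
  exact ⟨(h.mem_of_parent _ _ hc).2, (h.mem_of_parent _ _ hp).1⟩

/-- The agents that are not through form the path above the token. This path is closed upwards, so
its complement among the visited agents is closed downwards. -/
theorem mem_done_of_below (h : T.IsSearch M root t W D) {a b : A} (ha : a ∈ D)
    (hb : T.Below b a) : b ∈ D := by
  have hbW : b ∈ W := by
    rcases below_iff.1 hb with rfl | hb
    · exact h.done_sub ha
    · exact (h.mem_of_anc hb).2
  by_contra hbD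
  obtain ⟨c, hc, hcb⟩ := (h.active b hbW).1 hbD
  exact (h.active a (h.done_sub ha)).2 ⟨c, hc, hcb.trans hb⟩ ha

theorem token_notMem (h : T.IsSearch M root (some t') W D) : t' ∉ D :=
  (h.active t' (h.token_mem _ rfl)).2 ⟨t', rfl, .refl _⟩

theorem root_mem_done_iff (h : T.IsSearch M root t W D) : root ∈ D ↔ t = none := by
  rw [← not_iff_not, h.active root h.root_mem, ← Ne, Option.ne_none_iff_exists']
  exact exists_congr fun b => ⟨fun hb => hb.1, fun hb => ⟨hb, h.below_root b (h.token_mem b hb)⟩⟩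

/-- The pseudo-tree property inside a subtree that is through. It is available while the search
still goes on elsewhere, which is when UTIL messages may already be sent. -/
theorem comparable_of_done (h : T.IsSearch M root t W D) {a b d : A} (ha : a ∈ D)
    (hb : T.Below b a) (hd : M.graph.Adj b d) : T.Anc b d ∨ T.Anc d b :=
  have hbD := h.mem_done_of_below ha hb
  h.comparable _ (h.done_sub hbD) _ (h.done_adj _ hbD _ hd) hd

theorem initial (M : DCOP X F A V) (root : A) :
    IsSearch M root ⟨fun _ => none, fun _ => ∅⟩ (some root) {root} ∅ where
  rank := ⟨fun _ => 0, by simp⟩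
  back b d := by simp [anc_iff_parent]
  root_mem := by simp
  parent_root := rfl
  mem_of_parent := by simp
  below_root a ha := by
    obtain rfl := Finset.mem_singleton.1 ha
    exact .refl _
  comparable a ha b hb h := by
    obtain rfl := Finset.mem_singleton.1 ha
    obtain rfl := Finset.mem_singleton.1 hb
    exact (M.graph.loopless.irrefl _ h).elim
  done_sub := by simp
  done_adj := by simp
  token_mem b hb := by simpa using hb.symm
  active a ha := by
    obtain rfl := Finset.mem_singleton.1 ha
    simp [Below.refl]

theorem back_step [DecidableEq A] {a : A} (h : T.IsSearch M root (some a) W D)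
    (hn : ∀ b, M.graph.Adj a b → b ∈ W) :
    T.IsSearch M root (T.parent a) W (insert a D) where
  toIsDFSForest := h.toIsDFSForest
  root_mem := h.root_mem
  parent_root := h.parent_root
  mem_of_parent := h.mem_of_parent
  below_root := h.below_root
  comparable := h.comparable
  done_sub := Finset.insert_subset (h.token_mem _ rfl) h.done_sub
  done_adj b hb := by
    rcases Finset.mem_insert.1 hb with rfl | hb
    · exact hn
    · exact h.done_adj b hb
  token_mem b hb := (h.mem_of_parent _ _ hb).2
  active b hb := by
    rw [Finset.mem_insert, not_or, h.active b hb, ← anc_iff_parent]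
    constructor
    · rintro ⟨hba, c, hc, hcb⟩
      obtain rfl := Option.some_injective _ hc
      exact (below_iff.1 hcb).resolve_left (Ne.symm hba)
    · intro hba
      refine ⟨?_, a, rfl, hba.below⟩
      rintro rfl
      exact h.irrefl _ hba

/-- An agent that is through has only visited neighbors, so the unvisited `b` is adjacent to none of
them. Its visited neighbors therefore lie on the token path and become ancestors of the new leaf. -/
theorem visit_step [DecidableEq A] {a b : A} (h : T.IsSearch M root (some a) W D)
    (hab : M.graph.Adj a b) (hb : b ∉ W) {T' : TreeData A} {s : Finset A}
    (hp : T'.parent = Function.update T.parent b (some a))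
    (hq : T'.pseudo = Function.update T.pseudo b s)
    (hs : ∀ d, d ∈ s ↔ d ∈ W ∧ M.graph.Adj b d ∧ d ≠ a) :
    T'.IsSearch M root (some b) (insert b W) D := by
  have haW : a ∈ W := h.token_mem _ rfl
  have hleaf : ∀ c, T.parent c ≠ some b := fun c hc => hb (h.mem_of_parent _ _ hc).2
  have hne : a ≠ b := hab.ne
  have hanc : ∀ {u v}, v ≠ b → (T'.Anc u v ↔ T.Anc u v) :=
    fun hv => anc_update_iff_of_ne hp hleaf hv
  have hself : ∀ {u}, T'.Anc u b ↔ T.Below a u := anc_update_self_iff hp hleaf hne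
  have hadj : ∀ d ∈ W, M.graph.Adj b d → T.Below a d := by
    intro d hd hbd
    have hdD : d ∉ D := fun hdD => hb (h.done_adj d hdD b hbd.symm)
    obtain ⟨c, hc, hcd⟩ := (h.active d hd).1 hdD
    obtain rfl := Option.some_injective _ hc
    exact hcd
  have hWne : ∀ {d}, d ∈ W → d ≠ b := fun hd h => hb (h ▸ hd)
  have hbelow : ∀ {u v}, v ∈ W → (T'.Below v u ↔ T.Below v u) := fun hv => by
    rw [below_iff, below_iff, hanc (hWne hv)]
  have hup : ∀ {u}, T.Below a u → u ∈ W := fun hu => by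
    rcases below_iff.1 hu with rfl | hu
    · exact haW
    · exact (h.mem_of_anc hu).1
  refine ⟨⟨?_, ?_⟩, ?_, ?_, ?_, ?_, ?_, ?_, ?_, ?_, ?_⟩
  · obtain ⟨r, hr⟩ := h.rank
    -- As `b` has no children yet, its rank is only constrained from below.
    refine ⟨Function.update r b (r a + 1), fun c p hc => ?_⟩
    rw [hp] at hc
    by_cases hcb : c = b
    · subst hcb
      rw [Function.update_self] at hc
      obtain rfl := Option.some_injective _ hc
      simp [hne]
    · rw [Function.update_of_ne hcb] at hc
      rw [Function.update_of_ne hcb, Function.update_of_ne]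
      · exact hr _ _ hc
      · rintro rfl
        exact hleaf _ hc
  · intro c d
    by_cases hcb : c = b
    · subst hcb
      rw [hp, hq, Function.update_self, Function.update_self, hself, hs]
      constructor
      · rintro (hd | hd)
        · obtain rfl := Option.some_injective _ hd
          exact ⟨hab.symm, .refl _⟩
        · exact ⟨hd.2.1, hadj d hd.1 hd.2.1⟩
      · rintro ⟨hd, hda⟩
        by_cases hda' : a = d
        · exact Or.inl (congrArg some hda')
        · exact Or.inr ⟨hup hda, hd, Ne.symm hda'⟩
    · rw [hp, hq, Function.update_of_ne hcb, Function.update_of_ne hcb, hanc hcb]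
      exact h.back c d
  · exact Finset.mem_insert_of_mem h.root_mem
  · rw [hp, Function.update_of_ne (hWne h.root_mem)]
    exact h.parent_root
  · intro c p hc
    rw [hp] at hc
    by_cases hcb : c = b
    · subst hcb
      rw [Function.update_self] at hc
      obtain rfl := Option.some_injective _ hc
      exact ⟨Finset.mem_insert_self _ _, Finset.mem_insert_of_mem haW⟩
    · rw [Function.update_of_ne hcb] at hc
      exact ⟨Finset.mem_insert_of_mem (h.mem_of_parent _ _ hc).1,
        Finset.mem_insert_of_mem (h.mem_of_parent _ _ hc).2⟩
  · intro c hc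
    rcases Finset.mem_insert.1 hc with rfl | hc
    · exact (hself.2 (h.below_root a haW)).below
    · exact (hbelow hc).2 (h.below_root c hc)
  · intro c hc d hd hcd
    rcases Finset.mem_insert.1 hc with rfl | hcW
    · rcases Finset.mem_insert.1 hd with rfl | hdW
      · exact (hcd.ne rfl).elim
      · exact Or.inr (hself.2 (hadj d hdW hcd))
    · rcases Finset.mem_insert.1 hd with rfl | hdW
      · exact Or.inl (hself.2 (hadj c hcW hcd.symm))
      · rw [hanc (hWne hcW), hanc (hWne hdW)]
        exact h.comparable c hcW d hdW hcd
  · exact h.done_sub.trans (Finset.subset_insert _ _)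
  · exact fun c hc d hd => Finset.mem_insert_of_mem (h.done_adj c hc d hd)
  · intro c hc
    obtain rfl := Option.some_injective _ hc
    exact Finset.mem_insert_self _ _
  · intro c hc
    simp only [Option.some.injEq, exists_eq_left', below_iff, hself]
    rcases Finset.mem_insert.1 hc with rfl | hc
    · exact iff_of_true (fun hcD => hb (h.done_sub hcD)) (Or.inl rfl)
    · rw [h.active c hc]
      simp only [Option.some.injEq, exists_eq_left', (hWne hc).symm, false_or, below_iff]

/-- Without a token all visited agents are through, and their neighbors are visited; so being
through spreads along walks from the root. -/
theorem done_eq_univ [Fintype A] (h : T.IsSearch M root none W D) (hconn : M.graph.Connected)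
    (a : A) : a ∈ D := by
  have hWD : ∀ {b}, b ∈ W → b ∈ D := fun {b} hb => by
    by_contra hbD
    obtain ⟨c, hc, -⟩ := (h.active b hb).1 hbD
    cases hc
  obtain ⟨p⟩ := hconn.preconnected root a
  have : ∀ {u v : A}, M.graph.Walk u v → u ∈ D → v ∈ D := by
    intro u v p
    induction p with
    | nil => exact id
    | cons huv _ ih => exact fun hu => ih (hWD (h.done_adj _ hu _ huv))
  exact this p (hWD h.root_mem)

theorem isPseudoTree [Fintype A] (h : T.IsSearch M root none W D) (hconn : M.graph.Connected) :
    T.IsPseudoTree M root := by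
  have hW : ∀ a, a ∈ W := fun a => h.done_sub (h.done_eq_univ hconn a)
  exact ⟨h.parent_root, fun a p => h.adj_of_parent,
    fun a ha => (below_iff.1 (h.below_root a (hW a))).resolve_left ha,
    fun a b => h.comparable a (hW a) b (hW b)⟩

end IsSearch

end TreeData

/-! ### Constraints and separators in the tree -/

namespace ASPDPOP

open TreeData

variable {X F A V : Type*}

open scoped Classical in
/-- The utility of `f` under a substitution, `⊥` if a value is not in its domain. -/
noncomputable def extUtility (M : DCOP X F A V) (f : F) (τ : X → V) : WithBot ℝ :=
  if h : ∀ x ∈ M.scope f, τ x ∈ M.dom x then M.utility f (fun x => ⟨τ x.1, h x.1 x.2⟩) else ⊥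

section extUtility

variable {M : DCOP X F A V} {f : F} {τ τ' : X → V}

theorem extUtility_of_mem (h : ∀ x ∈ M.scope f, τ x ∈ M.dom x) :
    extUtility M f τ = M.utility f (fun x => ⟨τ x.1, h x.1 x.2⟩) := dif_pos h

theorem mem_dom_of_extUtility_ne_bot (h : extUtility M f τ ≠ ⊥) :
    ∀ x ∈ M.scope f, τ x ∈ M.dom x := by
  by_contra hn
  exact h (dif_neg hn)

theorem extUtility_congr (h : ∀ x ∈ M.scope f, τ x = τ' x) :
    extUtility M f τ = extUtility M f τ' := by
  have hiff : (∀ x ∈ M.scope f, τ x ∈ M.dom x) ↔ ∀ x ∈ M.scope f, τ' x ∈ M.dom x :=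
    forall₂_congr fun x hx => by rw [h x hx]
  by_cases hd : ∀ x ∈ M.scope f, τ x ∈ M.dom x
  · rw [extUtility_of_mem hd, extUtility_of_mem (hiff.1 hd)]
    congr 1
    ext x
    exact h x.1 x.2
  · rw [extUtility, extUtility, dif_neg hd, dif_neg (hd ∘ hiff.2)]

/-- `V` may be infinite; the finiteness comes from the domains. It guarantees that the maxima over
all substitutions exist. -/
theorem finite_range_extUtility : (Set.range (extUtility M f)).Finite := by
  refine ((Set.finite_range (M.utility f)).insert ⊥).subset ?_
  rintro _ ⟨τ, rfl⟩
  by_cases hd : ∀ x ∈ M.scope f, τ x ∈ M.dom x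
  · rw [extUtility_of_mem hd]
    exact Or.inr ⟨_, rfl⟩
  · exact Or.inl (dif_neg hd)

end extUtility

section Separator

variable [Fintype X] {M : DCOP X F A V} {T : TreeData A}

theorem mem_owned {a : A} {x : X} : x ∈ owned M a ↔ M.owner x = a := by simp [owned]

theorem mem_sep {a : A} {x : X} : x ∈ sep M T a ↔ T.Anc (M.owner x) a ∧
    ∃ y f, T.Below (M.owner y) a ∧ x ∈ M.scope f ∧ y ∈ M.scope f := by
  simp [sep, below_iff]

/-- The proper ancestors of a child of `a` are `a` and the ancestors of `a`. This is why the table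
of a child mentions only variables available at `a`. -/
theorem mem_sep_of_child {a c : A} (hc : T.parent c = some a) {x : X} (hx : x ∈ sep M T c)
    (hxa : M.owner x ≠ a) : x ∈ sep M T a := by
  obtain ⟨h1, y, f, hy, hxf, hyf⟩ := mem_sep.1 hx
  obtain ⟨p, hp, hpx⟩ := anc_iff_parent.1 h1
  obtain rfl := Option.some_injective _ (hc.symm.trans hp)
  exact mem_sep.2 ⟨(below_iff.1 hpx).resolve_left (Ne.symm hxa), y, f,
    hy.trans (anc_of_parent hc).below, hxf, hyf⟩

end Separator

section Structure

variable [Fintype F] {M : DCOP X F A V} {T : TreeData A}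

/-- Parents and pseudo-parents are the adjacent ancestors, and distinct owners of variables in one
scope are adjacent anyway, so only the position in the tree remains as a condition. -/
theorem mem_related (h : T.IsDFSForest M) {a : A} {f : F} :
    f ∈ related M T a ↔ (∀ x ∈ M.scope f, T.Below a (M.owner x)) ∧
      ∃ x ∈ M.scope f, M.owner x = a := by
  simp only [related, Finset.mem_filter, Finset.mem_univ, true_and]
  refine and_congr_left fun ⟨y, hy, hya⟩ => forall₂_congr fun x hx => ?_
  rw [h.back, below_iff]
  constructor
  · rintro (hx | hx)
    · exact Or.inl hx.symm
    · exact Or.inr hx.2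
  · rintro (hxa | hxa)
    · exact Or.inl hxa.symm
    · refine Or.inr ⟨⟨?_, f, y, hy, x, hx, hya, rfl⟩, hxa⟩
      rintro rfl
      exact h.irrefl _ hxa

/-- The agent to which `f` is related is the lowest owner of a variable in the scope. -/
theorem related_unique (h : T.IsDFSForest M) {a b : A} {f : F} (ha : f ∈ related M T a)
    (hb : f ∈ related M T b) : a = b := by
  rw [mem_related h] at ha hb
  obtain ⟨x, hx, rfl⟩ := ha.2
  obtain ⟨y, hy, rfl⟩ := hb.2
  rcases below_iff.1 (ha.1 y hy) with hab | hab
  · exact hab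
  · exact (h.asymm hab (hb.1 x hx)).elim

open scoped Classical in
/-- The constraints related to `a` or to a descendant of `a`. -/
noncomputable def subConstraints (M : DCOP X F A V) (T : TreeData A) (a : A) : Finset F :=
  Finset.univ.filter fun f => ∃ b, T.Below b a ∧ f ∈ related M T b

theorem mem_subConstraints {a : A} {f : F} :
    f ∈ subConstraints M T a ↔ ∃ b, T.Below b a ∧ f ∈ related M T b := by
  simp [subConstraints]

/-- Among the owners of scope variables inside the subtree, take one of largest rank. The other
owners are comparable with it and cannot be below it, so `f` is related to it. -/
theorem mem_subConstraints_of_comparable (h : T.IsDFSForest M) {a : A}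
    (hcl : ∀ b, T.Below b a → ∀ d, M.graph.Adj b d → T.Anc b d ∨ T.Anc d b) {f : F} {y : X}
    (hy : y ∈ M.scope f) (hya : T.Below (M.owner y) a) : f ∈ subConstraints M T a := by
  classical
  obtain ⟨r, hr⟩ := exists_rank_anc h.rank
  obtain ⟨z, hz, hmax⟩ := Finset.exists_max_image
    ((M.scope f).filter fun z => T.Below (M.owner z) a) (fun z => r (M.owner z))
    ⟨y, Finset.mem_filter.2 ⟨hy, hya⟩⟩
  rw [Finset.mem_filter] at hz
  refine mem_subConstraints.2 ⟨M.owner z, hz.2, (mem_related h).2 ⟨fun x hx => ?_, z, hz.1, rfl⟩⟩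
  by_cases hne : M.owner z = M.owner x
  · rw [hne]
    exact .refl _
  · rcases hcl _ hz.2 (M.owner x) ⟨hne, f, z, hz.1, x, hx, rfl, rfl⟩ with hzx | hxz
    · have := hmax x (Finset.mem_filter.2 ⟨hx, hzx.below.trans hz.2⟩)
      exact (this.not_gt (hr _ _ hzx)).elim
    · exact hxz.below

variable [Fintype X]

theorem mem_sep_of_related (h : T.IsDFSForest M) {a : A} {f : F} (hf : f ∈ related M T a) {x : X}
    (hx : x ∈ M.scope f) (hxa : M.owner x ≠ a) : x ∈ sep M T a := by
  obtain ⟨h1, y, hy, rfl⟩ := (mem_related h).1 hf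
  exact mem_sep.2 ⟨(below_iff.1 (h1 x hx)).resolve_left (Ne.symm hxa), y, f, .refl _, hx, hy⟩

theorem exists_subConstraints_of_mem_sep (h : T.IsDFSForest M) {a : A}
    (hcl : ∀ b, T.Below b a → ∀ d, M.graph.Adj b d → T.Anc b d ∨ T.Anc d b) {x : X}
    (hx : x ∈ sep M T a) : ∃ f ∈ subConstraints M T a, x ∈ M.scope f := by
  obtain ⟨-, y, f, hy, hxf, hyf⟩ := mem_sep.1 hx
  exact ⟨f, mem_subConstraints_of_comparable h hcl hyf hy, hxf⟩

/-- The constraint is related to some `b` below `a`. Both `a` and the owner of `x` lie on the chain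
above `b`, so they are comparable. -/
theorem below_or_mem_sep (h : T.IsDFSForest M) {a : A} {f : F} (hf : f ∈ subConstraints M T a)
    {x : X} (hx : x ∈ M.scope f) : T.Below (M.owner x) a ∨ x ∈ sep M T a := by
  obtain ⟨b, hb, hfb⟩ := mem_subConstraints.1 hf
  obtain ⟨h1, y, hy, rfl⟩ := (mem_related h).1 hfb
  rcases below_total hb (h1 x hx) with hax | hax
  · rcases below_iff.1 hax with hax | hax
    · exact Or.inl (hax ▸ .refl _)
    · exact Or.inr (mem_sep.2 ⟨hax, y, f, hb, hx, hy⟩)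
  · exact Or.inl hax

end Structure

/-! ### The Bellman equation on the tree -/

section Optimum

variable [Fintype F]

/-- The total utility of the constraints in the subtree of `a`. -/
noncomputable def subtreeUtility (M : DCOP X F A V) (T : TreeData A) (a : A) (τ : X → V) :
    WithBot ℝ :=
  ∑ f ∈ subConstraints M T a, extUtility M f τ

/-- Each constraint is counted once: it is related to a single agent (`related_unique`), and the
subtrees of distinct children are disjoint (`child_unique`). -/
theorem subtreeUtility_eq_add [Fintype A] {M : DCOP X F A V} {T : TreeData A}
    (h : T.IsDFSForest M) (a : A) (τ : X → V) :
    subtreeUtility M T a τ =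
      ∑ f ∈ related M T a, extUtility M f τ + ∑ c ∈ T.children a, subtreeUtility M T c τ := by
  classical
  have hsub : subConstraints M T a =
      related M T a ∪ (T.children a).biUnion (subConstraints M T) := by
    ext f
    simp only [mem_subConstraints, Finset.mem_union, Finset.mem_biUnion, mem_children]
    constructor
    · rintro ⟨b, hb, hf⟩
      rcases below_iff.1 hb with rfl | hb
      · exact Or.inl hf
      · obtain ⟨c, hc, hbc⟩ := anc_iff_child.1 hb
        exact Or.inr ⟨c, hc, b, hbc, hf⟩
    · rintro (hf | ⟨c, hc, b, hbc, hf⟩)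
      · exact ⟨a, .refl _, hf⟩
      · exact ⟨b, hbc.trans (anc_of_parent hc).below, hf⟩
  rw [subtreeUtility, hsub, Finset.sum_union, Finset.sum_biUnion]
  · rfl
  · intro c hc c' hc' hne
    refine Finset.disjoint_left.2 fun f hf hf' => hne ?_
    obtain ⟨b, hb, hfb⟩ := mem_subConstraints.1 hf
    obtain ⟨b', hb', hfb'⟩ := mem_subConstraints.1 hf'
    obtain rfl := related_unique h hfb hfb'
    exact h.child_unique (mem_children.1 hc) (mem_children.1 hc') hb hb'
  · refine Finset.disjoint_left.2 fun f hf hf' => ?_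
    obtain ⟨c, hc, hfc⟩ := Finset.mem_biUnion.1 hf'
    obtain ⟨b, hb, hfb⟩ := mem_subConstraints.1 hfc
    obtain rfl := related_unique h hf hfb
    exact h.asymm (anc_of_parent (mem_children.1 hc)) hb

variable [Fintype X]

theorem exists_isGreatest_subtreeUtility (M : DCOP X F A V) (T : TreeData A) (a : A) (σ : X → V) :
    ∃ U, IsGreatest (subtreeUtility M T a '' {τ | ∀ x ∈ sep M T a, τ x = σ x}) U := by
  have hfin : (Set.range (subtreeUtility M T a)).Finite := by
    have := Set.Finite.pi' fun f => finite_range_extUtility (M := M) (f := f)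
    refine (this.image fun g => ∑ f ∈ subConstraints M T a, g f).subset ?_
    rintro _ ⟨τ, rfl⟩
    exact ⟨fun f => extUtility M f τ, fun f => ⟨τ, rfl⟩, rfl⟩
  obtain ⟨U, hU, hmax⟩ := Set.exists_max_image _ id (hfin.subset (Set.image_subset_range _
    {τ | ∀ x ∈ sep M T a, τ x = σ x})) ⟨_, σ, fun _ _ => rfl, rfl⟩
  exact ⟨U, hU, hmax⟩

/-- The largest utility that the constraints in the subtree of `a` can reach, if the variables of the
separator have the given values. -/
noncomputable def optUtility (M : DCOP X F A V) (T : TreeData A) (a : A) (σ : X → V) : WithBot ℝ :=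
  (exists_isGreatest_subtreeUtility M T a σ).choose

/-- The sum computed by `a` if its children send optimal utilities. -/
noncomputable def joinUtility [Fintype A] (M : DCOP X F A V) (T : TreeData A) (a : A)
    (σ : X → V) : WithBot ℝ :=
  joinSum M T a (fun f => extUtility M f σ) (fun c => optUtility M T c σ)

variable {M : DCOP X F A V} {T : TreeData A} {a : A} {σ τ : X → V}

theorem subtreeUtility_le_optUtility (h : ∀ x ∈ sep M T a, τ x = σ x) :
    subtreeUtility M T a τ ≤ optUtility M T a σ :=
  (exists_isGreatest_subtreeUtility M T a σ).choose_spec.2 ⟨τ, h, rfl⟩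

theorem exists_subtreeUtility_eq (M : DCOP X F A V) (T : TreeData A) (a : A) (σ : X → V) :
    ∃ τ, (∀ x ∈ sep M T a, τ x = σ x) ∧ subtreeUtility M T a τ = optUtility M T a σ :=
  (exists_isGreatest_subtreeUtility M T a σ).choose_spec.1

theorem optUtility_congr (h : ∀ x ∈ sep M T a, σ x = τ x) :
    optUtility M T a σ = optUtility M T a τ := by
  apply le_antisymm
  · obtain ⟨ρ, hρ, hρσ⟩ := exists_subtreeUtility_eq M T a σ
    rw [← hρσ]
    exact subtreeUtility_le_optUtility fun x hx => (hρ x hx).trans (h x hx)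
  · obtain ⟨ρ, hρ, hρσ⟩ := exists_subtreeUtility_eq M T a τ
    rw [← hρσ]
    exact subtreeUtility_le_optUtility fun x hx => (hρ x hx).trans (h x hx).symm

/-- Transfers a table sent during the search to the tree as it grows later. -/
theorem optUtility_congr_tree {T' : TreeData A} (h1 : sep M T a = sep M T' a)
    (h2 : subConstraints M T a = subConstraints M T' a) :
    optUtility M T a σ = optUtility M T' a σ := by
  have h := (exists_isGreatest_subtreeUtility M T a σ).choose_spec
  have h' := (exists_isGreatest_subtreeUtility M T' a σ).choose_spec
  have e : subtreeUtility M T a = subtreeUtility M T' a := by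
    funext τ
    rw [subtreeUtility, subtreeUtility, h2]
  refine h.unique ?_
  rw [h1, e]
  exact h'

/-- A separator variable occurs in a constraint of the subtree, which has a finite utility at an
optimum. The rule for `table_max` needs this, since its body demands `value` atoms. -/
theorem mem_dom_of_optUtility_ne_bot (h : T.IsDFSForest M)
    (hcl : ∀ b, T.Below b a → ∀ d, M.graph.Adj b d → T.Anc b d ∨ T.Anc d b)
    (ho : optUtility M T a σ ≠ ⊥) : ∀ x ∈ sep M T a, σ x ∈ M.dom x := by
  intro x hx
  obtain ⟨τ, hτ, hτσ⟩ := exists_subtreeUtility_eq M T a σ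
  rw [← hτσ, subtreeUtility, WithBot.sum_ne_bot_iff] at ho
  obtain ⟨f, hf, hxf⟩ := exists_subConstraints_of_mem_sep h hcl hx
  rw [← hτ x hx]
  exact mem_dom_of_extUtility_ne_bot (ho f hf) x hxf

variable [Fintype A]

theorem joinUtility_ne_bot_iff : joinUtility M T a σ ≠ ⊥ ↔
    (∀ f ∈ related M T a, extUtility M f σ ≠ ⊥) ∧
      ∀ c ∈ T.children a, optUtility M T c σ ≠ ⊥ := by
  rw [joinUtility, joinSum, Ne, WithBot.add_eq_bot, not_or]
  exact and_congr WithBot.sum_ne_bot_iff WithBot.sum_ne_bot_iff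

theorem subtreeUtility_le_joinUtility (h : T.IsDFSForest M) :
    subtreeUtility M T a τ ≤ joinUtility M T a τ := by
  rw [subtreeUtility_eq_add h]
  exact add_le_add le_rfl
    (Finset.sum_le_sum fun c _ => subtreeUtility_le_optUtility fun _ _ => rfl)

/-- The optima of the children are reached by one common substitution: optimal substitutions for
their subtrees are glued, and constraints in a child's subtree see nothing outside it but its
separator, where all of them agree with `σ`. -/
theorem joinUtility_le_optUtility (h : T.IsDFSForest M) :
    joinUtility M T a σ ≤ optUtility M T a σ := by
  classical
  choose τ hτ hτσ using fun c => exists_subtreeUtility_eq M T c σ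
  -- The glued substitution: `τ c` on the subtree of each child `c`, and `σ` elsewhere. The chosen
  -- child is the only one possible.
  let g : X → V := fun x =>
    if hx : ∃ c, T.parent c = some a ∧ T.Below (M.owner x) c then τ hx.choose x else σ x
  have hg : ∀ {x}, T.Below a (M.owner x) → g x = σ x := by
    intro x hx
    refine dif_neg ?_
    rintro ⟨c, hc, hxc⟩
    exact h.asymm (anc_of_parent hc) (hx.trans hxc)
  have hgc : ∀ {x c}, T.parent c = some a → T.Below (M.owner x) c → g x = τ c x := by
    intro x c hc hxc
    have hx : ∃ c, T.parent c = some a ∧ T.Below (M.owner x) c := ⟨c, hc, hxc⟩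
    rw [show g x = τ hx.choose x from dif_pos hx,
      h.child_unique hx.choose_spec.1 hc hx.choose_spec.2 hxc]
  have hle : subtreeUtility M T a g ≤ optUtility M T a σ :=
    subtreeUtility_le_optUtility fun x hx => hg (mem_sep.1 hx).1.below
  refine le_trans (le_of_eq ?_) hle
  rw [subtreeUtility_eq_add h, joinUtility, joinSum]
  congr 1
  · refine Finset.sum_congr rfl fun f hf => extUtility_congr fun x hx => ?_
    exact (hg (((mem_related h).1 hf).1 x hx)).symm
  · refine Finset.sum_congr rfl fun c hc => ?_
    rw [mem_children] at hc
    rw [← hτσ]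
    refine Finset.sum_congr rfl fun f hf => extUtility_congr fun x hx => ?_
    rcases below_or_mem_sep h hf hx with hxc | hxc
    · exact (hgc hc hxc).symm
    · rw [hτ c x hxc]
      obtain ⟨p, hp, hpx⟩ := anc_iff_parent.1 (mem_sep.1 hxc).1
      obtain rfl := Option.some_injective _ (hc.symm.trans hp)
      exact (hg hpx).symm

/-- An optimal substitution for the whole subtree works: its `joinUtility` is squeezed between its
`subtreeUtility` and `optUtility`. -/
theorem exists_joinUtility_eq (h : T.IsDFSForest M) (a : A) (σ : X → V) :
    ∃ τ, (∀ x ∈ sep M T a, τ x = σ x) ∧ joinUtility M T a τ = optUtility M T a σ := by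
  obtain ⟨τ, hτ, hτσ⟩ := exists_subtreeUtility_eq M T a σ
  refine ⟨τ, hτ, le_antisymm ?_ (hτσ.symm.le.trans (subtreeUtility_le_joinUtility h))⟩
  exact (joinUtility_le_optUtility h).trans (optUtility_congr hτ).le

/-- The sum computed by `a` only depends on the variables of `a` and of its separator. -/
theorem joinUtility_congr (h : T.IsDFSForest M) (hs : ∀ x ∈ sep M T a, σ x = τ x)
    (ho : ∀ x, M.owner x = a → σ x = τ x) : joinUtility M T a σ = joinUtility M T a τ := by
  have key : ∀ x, (M.owner x ≠ a → x ∈ sep M T a) → σ x = τ x := fun x hx =>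
    (em (M.owner x = a)).elim (ho x) fun hxa => hs x (hx hxa)
  rw [joinUtility, joinUtility, joinSum, joinSum]
  congr 1
  · exact Finset.sum_congr rfl fun f hf => extUtility_congr fun x hx =>
      key x (mem_sep_of_related h hf hx)
  · exact Finset.sum_congr rfl fun c hc => optUtility_congr fun x hx =>
      key x (mem_sep_of_child (mem_children.1 hc) hx)

/-- If all agents make locally optimal choices, the result is optimal in each subtree. -/
theorem subtreeUtility_eq_optUtility (h : T.IsDFSForest M)
    (hopt : ∀ a, joinUtility M T a σ = optUtility M T a σ) (a : A) :
    subtreeUtility M T a σ = optUtility M T a σ := by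
  obtain ⟨r, hr⟩ := h.rank
  obtain ⟨n, hn⟩ : ∃ n, ∀ a, r a ≤ n :=
    ⟨Finset.univ.sup r, fun a => Finset.le_sup (Finset.mem_univ a)⟩
  -- Induction from the leaves upwards: ranks grow towards the leaves, so `n - r a` decreases from
  -- an agent to its children.
  have key : ∀ k a, n - r a = k → subtreeUtility M T a σ = optUtility M T a σ := by
    intro k
    induction k using Nat.strong_induction_on with
    | _ k ih =>
      rintro a rfl
      rw [subtreeUtility_eq_add h, ← hopt, joinUtility, joinSum]
      congr 1
      refine Finset.sum_congr rfl fun c hc => ih (n - r c) ?_ c rfl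
      have := hr _ _ (mem_children.1 hc)
      have := hn c
      omega
  exact key _ a rfl

/-- If the result is optimal in the subtree of an agent, so it is in the subtrees of its children. -/
theorem subtreeUtility_eq_optUtility_child (h : T.IsDFSForest M)
    (ha : subtreeUtility M T a σ = optUtility M T a σ) (hne : subtreeUtility M T a σ ≠ ⊥) {c : A}
    (hc : T.parent c = some a) :
    subtreeUtility M T c σ = optUtility M T c σ ∧ subtreeUtility M T c σ ≠ ⊥ := by
  have hle := joinUtility_le_optUtility (a := a) (σ := σ) h
  rw [← ha, subtreeUtility_eq_add h] at hle
  rw [subtreeUtility_eq_add h] at hne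
  -- A child below its optimum could be improved separately; since the sum is finite, this would
  -- improve the sum at `a`.
  refine ⟨WithBot.eq_of_sum_le_of_ne_bot
    (fun c _ => subtreeUtility_le_optUtility fun _ _ => rfl) hne hle c (mem_children.2 hc), ?_⟩
  rw [Ne, WithBot.add_eq_bot, not_or] at hne
  exact WithBot.sum_ne_bot_iff.1 hne.2 c (mem_children.2 hc)

theorem joinUtility_eq_optUtility (h : T.IsDFSForest M)
    (ha : subtreeUtility M T a σ = optUtility M T a σ) :
    joinUtility M T a σ = optUtility M T a σ :=
  le_antisymm (joinUtility_le_optUtility h) (ha ▸ subtreeUtility_le_joinUtility h)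

end Optimum

/-! ### From the root subtree to the total utility -/

section Root

variable {M : DCOP X F A V} {T : TreeData A} {root : A} {τ : X → V}

theorem sep_root [Fintype X] (hr : T.parent root = none) : sep M T root = ∅ := by
  refine Finset.eq_empty_of_forall_notMem fun x hx => ?_
  obtain ⟨p, hp, -⟩ := anc_iff_parent.1 (mem_sep.1 hx).1
  rw [hr] at hp
  cases hp

/-- A nonempty scope ensures that each constraint is related to some agent; with an empty scope it
would never be counted. -/
theorem subtreeUtility_root [Fintype F] [Fintype A] (h : T.IsDFSForest M)
    (hT : T.IsPseudoTree M root)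
    (hscope : ∀ f, (M.scope f).Nonempty) :
    subtreeUtility M T root τ = ∑ f, extUtility M f τ := by
  have : subConstraints M T root = Finset.univ := by
    refine Finset.eq_univ_of_forall fun f => ?_
    obtain ⟨y, hy⟩ := hscope f
    refine mem_subConstraints_of_comparable h (fun b _ d => hT.2.2.2 b d) hy (below_iff.2 ?_)
    exact (em (M.owner y = root)).imp id fun hne => hT.2.2.1 _ hne
  rw [subtreeUtility, this]

end Root

section Assignment

variable [Fintype F] {M : DCOP X F A V}

theorem sum_extUtility (s : M.Assignment) : ∑ f, extUtility M f (fun x => s x) = M.total s :=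
  Finset.sum_congr rfl fun _ _ => extUtility_of_mem fun x _ => (s x).2

/-- A value outside its domain would make a constraint with that variable contribute `⊥`; `hvar`
supplies such a constraint. -/
theorem exists_assignment (hvar : ∀ x, ∃ f, x ∈ M.scope f) {τ : X → V}
    (h : ∑ f, extUtility M f τ ≠ ⊥) : ∃ s : M.Assignment, τ = fun x => (s x : V) := by
  rw [WithBot.sum_ne_bot_iff] at h
  have hd : ∀ x, τ x ∈ M.dom x := fun x => by
    obtain ⟨f, hf⟩ := hvar x
    exact mem_dom_of_extUtility_ne_bot (h f (Finset.mem_univ f)) x hf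
  exact ⟨fun x => ⟨τ x, hd x⟩, rfl⟩

end Assignment

end ASPDPOP

theorem ASP.facts_union {α : Type*} (s t : Set α) : facts (s ∪ t) = facts s ∪ facts t := by
  ext r
  simp only [facts, Set.mem_ofPred_eq, Set.mem_union, or_and_right, exists_or]

/-! ### Phase 2: answer sets of the UTIL program -/

namespace ASPDPOP

open ASP TreeData

variable {X F A V : Type*}

theorem maxEq_congr {a : A} {u : WithBot ℝ} {l : List V}
    {S S' : Set (Atom X F A V)}     (h : ∀ U, .tableRow a U l ∈ S ↔ .tableRow a U l ∈ S') :
    MaxEq u {p | p.2 = .tableRow a p.1 l} S ↔ MaxEq u {p | p.2 = .tableRow a p.1 l} S' := by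
  have : {v | ∃ m ∈ S, (v, m) ∈ {p : WithBot ℝ × Atom X F A V | p.2 = .tableRow a p.1 l}} =
      {v | ∃ m ∈ S', (v, m) ∈ {p : WithBot ℝ × Atom X F A V | p.2 = .tableRow a p.1 l}} := by
    ext v
    simp [h]
  rw [MaxEq, MaxEq, this]

variable [LinearOrder X] {M : DCOP X F A V} {T : TreeData A} {a : A}

theorem util_mem_spec_iff [Fintype A] {f : F} {u : WithBot ℝ} {σ : X → V} :
    .util f u (args (M.scope f) σ) ∈ spec M T a ↔
      OwnsCon M a f ∧ (∀ x ∈ M.scope f, σ x ∈ M.dom x) ∧ u = extUtility M f σ := by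
  have : Atom.util f u (args (M.scope f) σ) ∈ spec M T a ↔ OwnsCon M a f ∧
      ∃ (τ : X → V) (h : ∀ x ∈ M.scope f, τ x ∈ M.dom x),
        u = M.utility f (fun x => ⟨τ x.1, h x.1 x.2⟩) ∧
        args (M.scope f) σ = args (M.scope f) τ := by
    simp [spec, conFacts, varFacts]
  rw [this]
  refine and_congr_right fun _ => ⟨?_, fun ⟨h, hu⟩ => ⟨σ, h, hu.trans (extUtility_of_mem h), rfl⟩⟩
  rintro ⟨τ, h, hu, hστ⟩
  rw [args_eq_args_iff] at hστ
  refine ⟨fun x hx => hστ x hx ▸ h x hx, ?_⟩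
  rw [extUtility_congr hστ, extUtility_of_mem h]
  exact hu

section Tables

variable [Fintype X] [Fintype F]

/-- `tableMax b U l` is an entry of the table of optimal utilities of the subtree of `b`. -/
def IsEntry (M : DCOP X F A V) (T : TreeData A) (b : A) (U : WithBot ℝ) (l : List V) : Prop :=
  ∃ σ, l = args (sep M T b) σ ∧ U = optUtility M T b σ ∧ U ≠ ⊥

theorem isEntry_args {b : A} {U : WithBot ℝ} {σ : X → V} :
    IsEntry M T b U (args (sep M T b) σ) ↔ U = optUtility M T b σ ∧ U ≠ ⊥ := by
  constructor
  · rintro ⟨τ, hl, hU, hne⟩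
    exact ⟨hU.trans (optUtility_congr (args_eq_args_iff.1 hl)).symm, hne⟩
  · rintro ⟨hU, hne⟩
    exact ⟨σ, rfl, hU, hne⟩

variable [Fintype A]

/-- The set `S` of atoms holds the utilities of the constraints related to `a` and the optimal tables
of the children of `a`. -/
structure HasTables (M : DCOP X F A V) (T : TreeData A) (a : A) (S : Set (Atom X F A V)) :
    Prop where
  util : ∀ f ∈ related M T a, ∀ u σ, .util f u (args (M.scope f) σ) ∈ S ↔
    (∀ x ∈ M.scope f, σ x ∈ M.dom x) ∧ u = extUtility M f σ
  table : ∀ c ∈ T.children a, ∀ U l, .tableMax c U l ∈ S ↔ IsEntry M T c U l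

variable {S : Set (Atom X F A V)} {σ : X → V} {v : F → WithBot ℝ} {u : A → WithBot ℝ}

theorem joinBody_holds_iff : (∀ b ∈ joinBody M T a σ v u, b.Holds S) ↔
    (∀ f ∈ related M T a, .util f (v f) (args (M.scope f) σ) ∈ S) ∧
    ∀ c ∈ T.children a, .tableMax c (u c) (args (sep M T c) σ) ∈ S := by
  constructor
  · exact fun h => ⟨fun f hf => h _ (Or.inl ⟨f, hf, rfl⟩), fun c hc => h _ (Or.inr ⟨c, hc, rfl⟩)⟩
  · rintro ⟨h1, h2⟩ b (⟨f, hf, rfl⟩ | ⟨c, hc, rfl⟩)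
    · exact h1 f hf
    · exact h2 c hc

theorem joinBody_redHolds {S' : Set (Atom X F A V)} (h : ∀ b ∈ joinBody M T a σ v u, b.Holds S')
    (R : Set (Atom X F A V)) : ∀ b ∈ joinBody M T a σ v u, b.RedHolds R S' := by
  rintro b hb
  have := h b hb
  rcases hb with ⟨f, hf, rfl⟩ | ⟨c, hc, rfl⟩
  · exact this
  · exact this

theorem HasTables.joinSum_eq (hS : HasTables M T a S)
    (h : ∀ b ∈ joinBody M T a σ v u, b.Holds S) : joinSum M T a v u = joinUtility M T a σ := by
  rw [joinBody_holds_iff] at h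
  rw [joinUtility, joinSum, joinSum]
  congr 1
  · exact Finset.sum_congr rfl fun f hf => ((hS.util f hf _ _).1 (h.1 f hf)).2
  · exact Finset.sum_congr rfl fun c hc =>
      (isEntry_args.1 ((hS.table c hc _ _).1 (h.2 c hc))).1

theorem HasTables.joinBody_holds (hS : HasTables M T a S) (hne : joinUtility M T a σ ≠ ⊥) :
    ∀ b ∈ joinBody M T a σ (fun f => extUtility M f σ) (fun c => optUtility M T c σ),
      b.Holds S := by
  rw [joinUtility_ne_bot_iff] at hne
  rw [joinBody_holds_iff]
  exact ⟨fun f hf => (hS.util f hf _ _).2 ⟨mem_dom_of_extUtility_ne_bot (hne.1 f hf), rfl⟩,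
    fun c hc => (hS.table c hc _ _).2 (isEntry_args.2 ⟨rfl, hne.2 c hc⟩)⟩

end Tables

section UtilProgram

variable [Fintype A] [Fintype X] [Fintype F] [LinearOrder V]

/-- All facts of the program of `a` in Phase 2 if `R` has been received. -/
def utilFacts (M : DCOP X F A V) (T : TreeData A) (a : A) (R : Set (Atom X F A V)) :
    Set (Atom X F A V) :=
  spec M T a ∪ {m | ∃ x ∈ sep M T a, m = .tableInfo a (M.owner x) x (M.dom x).min (M.dom x).max} ∪
    {m | ∃ x ∈ sep M T a, ∃ v ∈ M.dom x, m = .value x v} ∪ R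

/-- The immediate consequences of `S` and the facts `G` in the program of `a` in Phase 2. -/
def UtilDerived (M : DCOP X F A V) (T : TreeData A) (a : A) (G S : Set (Atom X F A V))
    (m : Atom X F A V) : Prop :=
  m ∈ G ∨
  (∃ σ v u, (∀ f ∈ related M T a, v f ≠ ⊥) ∧
    m = .tableRow a (joinSum M T a v u) (args (sep M T a) σ) ∧
    ∀ b ∈ joinBody M T a σ v u, b.Holds S) ∨
  ∃ σ U W, m = .tableMax a U (args (sep M T a) σ) ∧ (∀ x ∈ sep M T a, .value x (σ x) ∈ S) ∧
    .tableRow a W (args (sep M T a) σ) ∈ S ∧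
    MaxEq U {p | p.2 = .tableRow a p.1 (args (sep M T a) σ)} S

variable {R S : Set (Atom X F A V)}

theorem mem_utilProgram_iff {r : Rule (Atom X F A V)} :
    r ∈ facts (spec M T a) ∪ utilRules M T a ∪ facts R ↔
      (∃ m ∈ utilFacts M T a R, r = ⟨.atom m, ∅⟩) ∨
      (∃ (σ : X → V) (v : F → WithBot ℝ) (u : A → WithBot ℝ), (∀ f ∈ related M T a, v f ≠ ⊥) ∧
        r = ⟨.atom (.tableRow a (joinSum M T a v u) (args (sep M T a) σ)),
          joinBody M T a σ v u⟩) ∨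
      ∃ (σ : X → V) (U W : WithBot ℝ), r = ⟨.atom (.tableMax a U (args (sep M T a) σ)),
        {b | ∃ x ∈ sep M T a, b = .pos (.value x (σ x))} ∪
        {.pos (.tableRow a W (args (sep M T a) σ)),
          .isMax U {p | p.2 = .tableRow a p.1 (args (sep M T a) σ)}}⟩ := by
  rw [show (∃ m ∈ utilFacts M T a R, r = ⟨.atom m, ∅⟩) ↔ r ∈ facts (utilFacts M T a R) from Iff.rfl,
    utilFacts, facts_union, facts_union, facts_union, utilRules]
  simp only [Set.mem_union]
  constructor
  · rintro ((h | (((⟨σ, v, u, U, h, rfl, hr⟩ | h) | h) | h)) | h)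
    · tauto
    · exact Or.inr (Or.inl ⟨σ, v, u, h, hr⟩)
    · exact Or.inr (Or.inr h)
    · tauto
    · tauto
    · tauto
  · rintro ((((h | h) | h) | h) | ⟨σ, v, u, h, hr⟩ | h)
    · tauto
    · tauto
    · tauto
    · tauto
    · exact Or.inl (Or.inr (Or.inl (Or.inl (Or.inl ⟨σ, v, u, _, h, rfl, hr⟩))))
    · exact Or.inl (Or.inr (Or.inl (Or.inl (Or.inr h))))

/-- One direction is supportedness, the other that `S` satisfies the rules. -/
theorem mem_utilAnswerSet_iff (h : IsAnswerSet (facts (spec M T a) ∪ utilRules M T a ∪ facts R) S)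
    {m : Atom X F A V} : m ∈ S ↔ UtilDerived M T a (utilFacts M T a R) S m := by
  constructor
  · intro hm
    obtain ⟨r, hr, hb, hd⟩ := h.supported hm
    rcases mem_utilProgram_iff.1 hr with ⟨m', hm', rfl⟩ | ⟨σ, v, u, hv, rfl⟩ | ⟨σ, U, W, rfl⟩
    · rcases hd with hd | ⟨l, C, u, hd, -⟩
      · cases hd
        exact Or.inl hm'
      · cases hd
    · rcases hd with hd | ⟨l, C, u, hd, -⟩
      · cases hd
        exact Or.inr (Or.inl ⟨σ, v, u, hv, rfl, hb⟩)
      · cases hd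
    · rcases hd with hd | ⟨l, C, u, hd, -⟩
      · cases hd
        refine Or.inr (Or.inr ⟨σ, U, W, rfl, fun x hx => hb _ (Or.inl ⟨x, hx, rfl⟩),
          hb _ (Or.inr (Or.inl rfl)), hb _ (Or.inr (Or.inr rfl))⟩)
      · cases hd
  · rintro (hm | ⟨σ, v, u, hv, rfl, hb⟩ | ⟨σ, U, W, rfl, hx, hW, hU⟩)
    · exact h.1 _ (mem_utilProgram_iff.2 (Or.inl ⟨m, hm, rfl⟩)) (by simp)
    · exact h.1 _ (mem_utilProgram_iff.2 (Or.inr (Or.inl ⟨σ, v, u, hv, rfl⟩))) hb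
    · refine h.1 _ (mem_utilProgram_iff.2 (Or.inr (Or.inr ⟨σ, U, W, rfl⟩))) ?_
      rintro b (⟨x, hx', rfl⟩ | rfl | rfl)
      · exact hx x hx'
      · exact hW
      · exact hU

/-- The messages that `a` has received from its children: tables and information about variables. -/
def IsUtilMessage (B : Finset A) (R : Set (Atom X F A V)) : Prop :=
  ∀ m ∈ R, ∃ b ∈ B, (∃ U l, m = .tableMax b U l) ∨ ∃ d x lb ub, m = .tableInfo b d x lb ub

/-- A fixed point is stable because the program is stratified: facts and received tables, then rows,
then the own table. By `ha` the own table is not among the tables of the children. -/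
theorem isAnswerSet_of_utilDerived (ha : a ∉ T.children a)
    (h : ∀ m, m ∈ S ↔ UtilDerived M T a (utilFacts M T a R) S m) :
    IsAnswerSet (facts (spec M T a) ∪ utilRules M T a ∪ facts R) S := by
  classical
  refine isAnswerSet_of_level ?_ (fun m => match m with
    | .tableRow _ _ _ => 1
    | .tableMax b _ _ => if b = a then 2 else 0
    | _ => 0) fun m hm => ?_
  · intro r hr hb
    rcases mem_utilProgram_iff.1 hr with ⟨m', hm', rfl⟩ | ⟨σ, v, u, hv, rfl⟩ | ⟨σ, U, W, rfl⟩
    · exact (h _).2 (Or.inl hm')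
    · exact (h _).2 (Or.inr (Or.inl ⟨σ, v, u, hv, rfl, hb⟩))
    · exact (h _).2 (Or.inr (Or.inr ⟨σ, U, W, rfl, fun x hx => hb _ (Or.inl ⟨x, hx, rfl⟩),
          hb _ (Or.inr (Or.inl rfl)), hb _ (Or.inr (Or.inr rfl))⟩))
  · rcases (h m).1 hm with hm | ⟨σ, v, u, hv, rfl, hb⟩ | ⟨σ, U, W, rfl, hx, hW, hU⟩
    · exact ⟨_, mem_utilProgram_iff.2 (Or.inl ⟨m, hm, rfl⟩), Or.inl rfl, by simp⟩
    · refine ⟨_, mem_utilProgram_iff.2 (Or.inr (Or.inl ⟨σ, v, u, hv, rfl⟩)), Or.inl rfl, ?_⟩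
      intro S' hS' hl
      apply joinBody_redHolds
      rw [joinBody_holds_iff] at hb ⊢
      refine ⟨fun f hf => hl _ (hb.1 f hf) (by simp), fun c hc => hl _ (hb.2 c hc) ?_⟩
      have : c ≠ a := fun h => ha (h ▸ hc)
      simp [this]
    · refine ⟨_, mem_utilProgram_iff.2 (Or.inr (Or.inr ⟨σ, U, W, rfl⟩)), Or.inl rfl, ?_⟩
      intro S' hS' hl
      rintro b (⟨x, hx', rfl⟩ | rfl | rfl)
      · exact hl _ (hx x hx') (by simp)
      · exact hl _ hW (by simp)
      -- All rows have a lower level, so the aggregate ranges over the same rows in `S'` as in `S`.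
      · refine ⟨hU, (maxEq_congr fun U' => ⟨fun hU' => hl _ hU' (by simp), fun hU' => hS' hU'⟩).1 hU⟩

/-- The fixed point is built in two layers, `S₁` with the rows and `S₂` with the own table. Neither
layer adds atoms that the bodies of earlier layers read, so nothing has to be iterated. -/
theorem exists_isAnswerSet_util (ha : a ∉ T.children a) (hR : IsUtilMessage (T.children a) R) :
    ∃ S, IsAnswerSet (facts (spec M T a) ∪ utilRules M T a ∪ facts R) S := by
  set G := utilFacts M T a R with hG
  have hrow : ∀ b U l, .tableRow b U l ∉ G := by
    intro b U l h
    rcases h with ((h | h) | h) | h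
    · simp [spec, conFacts, varFacts] at h
    · simp at h
    · simp at h
    · obtain ⟨c, -, ⟨U, l, h⟩ | ⟨d, x, lb, ub, h⟩⟩ := hR _ h <;> cases h
  have hmax : ∀ U l, .tableMax a U l ∉ G := by
    intro U l h
    rcases h with ((h | h) | h) | h
    · simp [spec, conFacts, varFacts] at h
    · simp at h
    · simp at h
    · obtain ⟨c, hc, ⟨U, l, h⟩ | ⟨d, x, lb, ub, h⟩⟩ := hR _ h <;> cases h
      exact ha hc
  let S₁ : Set (Atom X F A V) := {m | m ∈ G ∨ ∃ σ v u, (∀ f ∈ related M T a, v f ≠ ⊥) ∧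
    m = .tableRow a (joinSum M T a v u) (args (sep M T a) σ) ∧
    ∀ b ∈ joinBody M T a σ v u, b.Holds G}
  let S₂ : Set (Atom X F A V) := {m | m ∈ S₁ ∨ ∃ σ U W, m = .tableMax a U (args (sep M T a) σ) ∧
    (∀ x ∈ sep M T a, .value x (σ x) ∈ S₁) ∧ .tableRow a W (args (sep M T a) σ) ∈ S₁ ∧
    MaxEq U {p | p.2 = .tableRow a p.1 (args (sep M T a) σ)} S₁}
  have hutil : ∀ f u l, .util f u l ∈ S₂ ↔ .util f u l ∈ G := by simp [S₂, S₁]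
  have htab : ∀ c, c ≠ a → ∀ u l, .tableMax c u l ∈ S₂ ↔ .tableMax c u l ∈ G := by
    intro c hc
    simp [S₂, S₁, hc]
  have hval : ∀ x v, .value x v ∈ S₂ ↔ .value x v ∈ S₁ := by simp [S₂, S₁]
  have hrow' : ∀ u l, .tableRow a u l ∈ S₂ ↔ .tableRow a u l ∈ S₁ := by simp [S₂]
  have hbody : ∀ σ v u, (∀ b ∈ joinBody M T a σ v u, b.Holds S₂) ↔
      ∀ b ∈ joinBody M T a σ v u, b.Holds G := by
    intro σ v u
    rw [joinBody_holds_iff, joinBody_holds_iff]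
    simp only [hutil]
    exact and_congr_right fun _ => forall₂_congr fun c hc => htab c (fun h => ha (h ▸ hc)) _ _
  refine ⟨S₂, isAnswerSet_of_utilDerived ha fun m => ?_⟩
  simp only [UtilDerived, hbody, hval, hrow', maxEq_congr fun U => hrow' U _]
  exact or_assoc

theorem HasTables.of_utilAnswerSet (ha : a ∉ T.children a)
    (hR : IsUtilMessage (T.children a) R)
    (hT : ∀ c ∈ T.children a, ∀ U l, .tableMax c U l ∈ R ↔ IsEntry M T c U l)
    (hrel : ∀ f ∈ related M T a, OwnsCon M a f)
    (h : IsAnswerSet (facts (spec M T a) ∪ utilRules M T a ∪ facts R) S) :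
    HasTables M T a S where
  util f hf u σ := by
    have : .util f u (args (M.scope f) σ) ∈ S ↔ .util f u (args (M.scope f) σ) ∈ spec M T a := by
      rw [mem_utilAnswerSet_iff h]
      have hn : .util f u (args (M.scope f) σ) ∉ R := fun hm => by
        obtain ⟨c, hc, ⟨U, l, hm⟩ | ⟨d, x, lb, ub, hm⟩⟩ := hR _ hm <;> cases hm
      simp [UtilDerived, utilFacts, hn]
    rw [this, util_mem_spec_iff]
    exact and_iff_right (hrel f hf)
  table c hc U l := by
    have hca : c ≠ a := fun h => ha (h ▸ hc)
    rw [mem_utilAnswerSet_iff h, ← hT c hc]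
    simp [UtilDerived, utilFacts, hca, spec, conFacts, varFacts]

/-- The table computed by `a` in Phase 2 is the table of the optimal utilities of its subtree. -/
theorem tableMax_mem_iff (hd : T.IsDFSForest M)
    (hcl : ∀ b, T.Below b a → ∀ d, M.graph.Adj b d → T.Anc b d ∨ T.Anc d b)
    (hR : IsUtilMessage (T.children a) R)
    (hT : ∀ c ∈ T.children a, ∀ U l, .tableMax c U l ∈ R ↔ IsEntry M T c U l)
    (h : IsAnswerSet (facts (spec M T a) ∪ utilRules M T a ∪ facts R) S) (U : WithBot ℝ)
    (l : List V) : .tableMax a U l ∈ S ↔ IsEntry M T a U l := by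
  have ha : a ∉ T.children a := fun ha => hd.irrefl a (anc_of_parent (mem_children.1 ha))
  have hS := HasTables.of_utilAnswerSet ha hR hT (fun f hf => ((mem_related hd).1 hf).2) h
  have hmaxR : ∀ U l, .tableMax a U l ∉ R := fun U l hm => by
    obtain ⟨c, hc, ⟨U, l, hm⟩ | ⟨d, x, lb, ub, hm⟩⟩ := hR _ hm <;> cases hm
    exact ha hc
  have hrowR : ∀ U l, .tableRow a U l ∉ R := fun U l hm => by
    obtain ⟨c, hc, ⟨U, l, hm⟩ | ⟨d, x, lb, ub, hm⟩⟩ := hR _ hm <;> cases hm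
  -- The rows over given separator values are the finite sums over all completions; several
  -- completions may yield the same arguments.
  have hrow : ∀ U σ, .tableRow a U (args (sep M T a) σ) ∈ S ↔
      ∃ τ, (∀ x ∈ sep M T a, τ x = σ x) ∧ U = joinUtility M T a τ ∧ U ≠ ⊥ := by
    intro U σ
    have : .tableRow a U (args (sep M T a) σ) ∈ S ↔
        ∃ τ v u, (∀ f ∈ related M T a, v f ≠ ⊥) ∧ (U = joinSum M T a v u ∧
          args (sep M T a) σ = args (sep M T a) τ) ∧ ∀ b ∈ joinBody M T a τ v u, b.Holds S := by
      rw [mem_utilAnswerSet_iff h]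
      simp [UtilDerived, utilFacts, hrowR, spec, conFacts, varFacts]
    rw [this]
    constructor
    · rintro ⟨τ, v, u, hv, ⟨hU, hστ⟩, hb⟩
      refine ⟨τ, fun x hx => (args_eq_args_iff.1 hστ x hx).symm, hU.trans (hS.joinSum_eq hb), ?_⟩
      rw [hU, joinSum, Ne, WithBot.add_eq_bot, not_or]
      refine ⟨WithBot.sum_ne_bot_iff.2 hv, WithBot.sum_ne_bot_iff.2 fun c hc => ?_⟩
      exact (isEntry_args.1 ((hS.table c hc _ _).1 ((joinBody_holds_iff.1 hb).2 c hc))).2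
    · rintro ⟨τ, hτ, rfl, hne⟩
      exact ⟨τ, fun f => extUtility M f τ, fun c => optUtility M T c τ,
        (joinUtility_ne_bot_iff.1 hne).1, ⟨rfl, args_eq_args_iff.2 fun x hx => (hτ x hx).symm⟩,
        hS.joinBody_holds hne⟩
  have hmaxEq : ∀ U σ, MaxEq U {p | p.2 = .tableRow a p.1 (args (sep M T a) σ)} S ↔
      IsGreatest (insert ⊥ {U | ∃ τ, (∀ x ∈ sep M T a, τ x = σ x) ∧
        U = joinUtility M T a τ ∧ U ≠ ⊥}) U := by
    intro U σ
    have : {v | ∃ m ∈ S, (v, m) ∈ {p : WithBot ℝ × Atom X F A V |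
        p.2 = .tableRow a p.1 (args (sep M T a) σ)}} = {U | ∃ τ, (∀ x ∈ sep M T a, τ x = σ x) ∧
        U = joinUtility M T a τ ∧ U ≠ ⊥} := by
      ext v
      simp [hrow]
    rw [MaxEq, this]
  have hmax : .tableMax a U l ∈ S ↔ ∃ σ W, l = args (sep M T a) σ ∧
      (∀ x ∈ sep M T a, .value x (σ x) ∈ S) ∧ .tableRow a W (args (sep M T a) σ) ∈ S ∧
      MaxEq U {p | p.2 = .tableRow a p.1 (args (sep M T a) σ)} S := by
    rw [mem_utilAnswerSet_iff h]
    simp only [UtilDerived, utilFacts, Set.mem_union, hmaxR]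
    constructor
    · rintro ((((h | h) | h) | h) | ⟨σ, v, u, -, h, -⟩ | ⟨σ, U', W, h, h'⟩)
      · simp [spec, conFacts, varFacts] at h
      · simp at h
      · simp at h
      · exact h.elim
      · cases h
      · obtain ⟨-, rfl, rfl⟩ := Atom.tableMax.inj h
        exact ⟨σ, W, rfl, h'⟩
    · rintro ⟨σ, W, rfl, h'⟩
      exact Or.inr (Or.inr ⟨σ, U, W, rfl, h'⟩)
  rw [hmax]
  constructor
  · rintro ⟨σ, W, rfl, -, hW, hU⟩
    rw [hmaxEq] at hU
    rw [hrow] at hW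
    rw [isEntry_args]
    have hWU : W ≤ U := hU.2 (Or.inr hW)
    obtain ⟨τ₀, hτ₀, rfl, hne₀⟩ := hW
    -- The body demands some row, and rows are finite, so `#max` does not take its default `#inf`.
    have hUne : U ≠ ⊥ := fun h => hne₀ (le_bot_iff.1 (h ▸ hWU))
    refine ⟨le_antisymm ?_ ?_, hUne⟩
    · obtain ⟨τ, hτ, rfl, -⟩ := hU.1.resolve_left hUne
      exact (joinUtility_le_optUtility hd).trans (optUtility_congr hτ).le
    · obtain ⟨τ, hτ, hτσ⟩ := exists_joinUtility_eq hd a σ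
      by_cases hne : joinUtility M T a τ = ⊥
      · rw [← hτσ, hne]
        exact bot_le
      · rw [← hτσ]
        exact hU.2 (Or.inr ⟨τ, hτ, rfl, hne⟩)
  · rintro ⟨σ, rfl, rfl, hne⟩
    obtain ⟨τ, hτ, hτσ⟩ := exists_joinUtility_eq hd a σ
    refine ⟨σ, optUtility M T a σ, rfl, fun x hx => ?_, ?_, ?_⟩
    · refine (mem_utilAnswerSet_iff h).2 (Or.inl (Or.inl (Or.inr ⟨x, hx, _, ?_, rfl⟩)))
      exact mem_dom_of_optUtility_ne_bot hd hcl hne x hx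
    · exact (hrow _ _).2 ⟨τ, hτ, hτσ.symm, hne⟩
    · rw [hmaxEq]
      refine ⟨Or.inr ⟨τ, hτ, hτσ.symm, hne⟩, ?_⟩
      rintro U (rfl | ⟨ρ, hρ, rfl, -⟩)
      · exact bot_le
      · exact (joinUtility_le_optUtility hd).trans (optUtility_congr hρ).le

end UtilProgram

end ASPDPOP

/-! ### Phase 3: answer sets of the VALUE program -/

namespace ASPDPOP

open ASP TreeData

variable {X F A V : Type*} [LinearOrder X] [Fintype A] [Fintype X] [Fintype F]
  {M : DCOP X F A V} {T : TreeData A} {a : A} {G S : Set (Atom X F A V)} {s σ : X → V}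

/-- The body of the choice rule for `row`. -/
def rowBody (M : DCOP X F A V) (T : TreeData A) (a : A) (σ : X → V) (v : F → WithBot ℝ)
    (u : A → WithBot ℝ) : Set (BodyLit (Atom X F A V)) :=
  {b | ∃ x ∈ sep M T a, b = .pos (.solution (M.owner x) x (σ x))} ∪
    {.pos (.tableMax a (joinSum M T a v u) (args (sep M T a) σ))} ∪ joinBody M T a σ v u

theorem mem_valueProgram_iff {r : Rule (Atom X F A V)} :
    r ∈ facts G ∪ valueRules M T a ↔
      (∃ m ∈ G, r = ⟨.atom m, ∅⟩) ∨
      (∃ (σ : X → V) (v : F → WithBot ℝ) (u : A → WithBot ℝ),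
        r = ⟨.choice 0 {.row (joinSum M T a v u) (args (owned M a) σ)} ⊤, rowBody M T a σ v u⟩) ∨
      r = ⟨.empty,
        {.nafCard 1 {m | ∃ (U : WithBot ℝ) (σ : X → V), m = .row U (args (owned M a) σ)} 1}⟩ ∨
      ∃ (σ : X → V) (U : WithBot ℝ), ∃ x ∈ owned M a,
        r = ⟨.atom (.solution a x (σ x)), {.pos (.row U (args (owned M a) σ))}⟩ := by
  constructor
  · rintro (h | ((⟨σ, v, u, U, rfl, hr⟩ | h) | h))
    · exact Or.inl h
    · exact Or.inr (Or.inl ⟨σ, v, u, hr⟩)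
    · exact Or.inr (Or.inr (Or.inl h))
    · exact Or.inr (Or.inr (Or.inr h))
  · rintro (h | ⟨σ, v, u, hr⟩ | h | h)
    · exact Or.inl h
    · exact Or.inr (Or.inl (Or.inl ⟨σ, v, u, _, rfl, hr⟩))
    · exact Or.inr (Or.inl (Or.inr h))
    · exact Or.inr (Or.inr h)

/-- The facts available to `a` in Phase 3, if the values of the ancestors are those of `s`. -/
structure HasValueFacts (M : DCOP X F A V) (T : TreeData A) (a : A) (s : X → V)
    (G : Set (Atom X F A V)) : Prop extends HasTables M T a G where
  table_self : ∀ U l, .tableMax a U l ∈ G ↔ IsEntry M T a U l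
  row : ∀ U l, .row U l ∉ G
  solution : ∀ b x v, .solution b x v ∈ G ↔ T.Anc b a ∧ b = M.owner x ∧ v = s x

/-- The values chosen by `a` reach the optimal utility of its subtree, which is finite. -/
def IsLocallyOptimal (M : DCOP X F A V) (T : TreeData A) (a : A) (σ : X → V) : Prop :=
  joinUtility M T a σ = optUtility M T a σ ∧ optUtility M T a σ ≠ ⊥

theorem mem_or_of_mem_valueAnswerSet (h : IsAnswerSet (facts G ∪ valueRules M T a) S)
    {m : Atom X F A V} (hm : m ∈ S) : m ∈ G ∨
      (∃ σ v u, m = .row (joinSum M T a v u) (args (owned M a) σ) ∧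
        ∀ b ∈ rowBody M T a σ v u, b.Holds S) ∨
      ∃ σ U, ∃ x ∈ owned M a, m = .solution a x (σ x) ∧ .row U (args (owned M a) σ) ∈ S := by
  obtain ⟨r, hr, hb, hd⟩ := h.supported hm
  rcases mem_valueProgram_iff.1 hr with ⟨m', hm', rfl⟩ | ⟨σ, v, u, rfl⟩ | rfl | ⟨σ, U, x, hx, rfl⟩
  · rcases hd with hd | ⟨l, C, u, hd, -⟩ <;> cases hd
    exact Or.inl hm'
  · rcases hd with hd | ⟨l, C, u, hd, hmC⟩ <;> cases hd
    exact Or.inr (Or.inl ⟨σ, v, u, hmC, hb⟩)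
  · rcases hd with hd | ⟨l, C, u, hd, -⟩ <;> cases hd
  · rcases hd with hd | ⟨l, C, u, hd, -⟩ <;> cases hd
    exact Or.inr (Or.inr ⟨σ, U, x, hx, rfl, hb _ rfl⟩)

theorem exists_unique_row (h : IsAnswerSet (facts G ∪ valueRules M T a) S) :
    ∃ m, {m | ∃ (U : WithBot ℝ) (σ : X → V), m = .row U (args (owned M a) σ)} ∩ S = {m} := by
  have hc : CardIn 1 {m | ∃ (U : WithBot ℝ) (σ : X → V), m = .row U (args (owned M a) σ)} 1 S := by
    by_contra hn
    refine h.1 _ (mem_valueProgram_iff.2 (Or.inr (Or.inr (Or.inl rfl)))) ?_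
    rintro b rfl
    exact hn
  exact Set.encard_eq_one.1 (le_antisymm hc.2 hc.1)

/-- In Phase 3 `a` chooses values of its variables that are optimal for its subtree, given those of
its ancestors. -/
theorem exists_of_valueAnswerSet (hd : T.IsDFSForest M) (hG : HasValueFacts M T a s G)
    (h : IsAnswerSet (facts G ∪ valueRules M T a) S) :
    ∃ σ, (∀ x, M.owner x ≠ a → σ x = s x) ∧ IsLocallyOptimal M T a σ ∧
      valueAnswer S = {m | ∃ x, T.Below a (M.owner x) ∧ m = .solution (M.owner x) x (σ x)} := by
  classical
  obtain ⟨m, hm⟩ := exists_unique_row h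
  have hmS : m ∈ S := (hm.ge rfl : m ∈ _ ∩ S).2
  have hGS : ∀ m ∈ G, m ∈ S := fun m hm => h.mem_of_fact Set.subset_union_left hm
  obtain ⟨U₀, σ₀, rfl⟩ := (hm.ge rfl : m ∈ _ ∩ S).1
  rcases mem_or_of_mem_valueAnswerSet h hmS with hmG | ⟨σ, v, u, hrow, hb⟩ | ⟨σ, U, x, hx, hrow, -⟩
  · exact (hG.row _ _ hmG).elim
  · rw [hrow] at hm hmS
    have htab : ∀ b U l, .tableMax b U l ∈ S ↔ .tableMax b U l ∈ G := by
      refine fun b U l => ⟨fun hm => ?_, hGS _⟩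
      rcases mem_or_of_mem_valueAnswerSet h hm with hm | ⟨σ, v, u, hm, -⟩ | ⟨σ, U, x, hx, hm, -⟩
      · exact hm
      · cases hm
      · cases hm
    have hS : HasTables M T a S := by
      refine ⟨fun f hf u τ => ?_, fun c hc U l => ?_⟩
      · rw [← hG.util f hf]
        refine ⟨fun hm => ?_, hGS _⟩
        rcases mem_or_of_mem_valueAnswerSet h hm with hm | ⟨σ, v, u, hm, -⟩ | ⟨σ, U, x, hx, hm, -⟩
        · exact hm
        · cases hm
        · cases hm
      · rw [htab, hG.table c hc]
    have hsol : ∀ b x v, .solution b x v ∈ S ↔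
        (T.Anc b a ∧ b = M.owner x ∧ v = s x) ∨ b = a ∧ M.owner x = a ∧ v = σ x := by
      intro b x v
      constructor
      · intro hm'
        rcases mem_or_of_mem_valueAnswerSet h hm' with
          hm' | ⟨σ', v', u', hm', -⟩ | ⟨σ', U', x, hx, hm', hr⟩
        · exact Or.inl ((hG.solution _ _ _).1 hm')
        · cases hm'
        · obtain ⟨rfl, rfl, rfl⟩ := Atom.solution.inj hm'
          refine Or.inr ⟨rfl, mem_owned.1 hx, ?_⟩
          -- The cardinality constraint leaves a single row, so every `solution` atom of `a` comes
          -- from it.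
          have := hm.le ⟨⟨U', σ', rfl⟩, hr⟩
          exact args_eq_args_iff.1 (Atom.row.inj this).2 _ hx
      · rintro (hb | ⟨rfl, hx, rfl⟩)
        · exact hGS _ ((hG.solution _ _ _).2 hb)
        · refine h.1 _ (mem_valueProgram_iff.2
            (Or.inr (Or.inr (Or.inr ⟨σ, joinSum M T b v u, x, mem_owned.2 hx, rfl⟩)))) ?_
          rintro b' rfl
          exact hmS
    have hσ : ∀ x ∈ sep M T a, σ x = s x := by
      intro x hx
      have hxa := (mem_sep.1 hx).1
      rcases (hsol _ _ _).1 (hb _ (Or.inl (Or.inl ⟨x, hx, rfl⟩))) with hx' | hx'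
      · exact hx'.2.2
      · exact (hd.irrefl a (hx'.1 ▸ hxa)).elim
    have hne : ∀ {b}, T.Anc b a → b ≠ a := fun hb hba => hd.irrefl a (hba ▸ hb)
    -- The ground instance that derives the row fixes `σ` only on the variables of `a` and its
    -- separator; elsewhere `σ` is arbitrary and is replaced by `s`.
    let ρ : X → V := fun x => if M.owner x = a then σ x else s x
    have hρ : ∀ x, M.owner x = a → ρ x = σ x := fun x hx => if_pos hx
    have hρs : ∀ x, M.owner x ≠ a → ρ x = s x := fun x hx => if_neg hx
    have hρsep : ∀ x ∈ sep M T a, ρ x = σ x := fun x hx =>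
      (hρs x (hne (mem_sep.1 hx).1)).trans (hσ x hx).symm
    have hself : .tableMax a (joinSum M T a v u) (args (sep M T a) σ) ∈ S :=
      hb _ (Or.inl (Or.inr rfl))
    -- The sum in the row occurs in the own table, so it is the optimum and finite.
    rw [htab, hG.table_self, isEntry_args,
      hS.joinSum_eq fun b hb' => hb b (Or.inr hb')] at hself
    refine ⟨ρ, hρs, ?_, ?_⟩
    · rw [IsLocallyOptimal, joinUtility_congr hd hρsep hρ, optUtility_congr hρsep]
      exact ⟨hself.1, hself.1 ▸ hself.2⟩
    · ext m
      constructor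
      · rintro ⟨hm, b, x, v, rfl⟩
        rcases (hsol _ _ _).1 hm with ⟨hb, rfl, rfl⟩ | ⟨rfl, hx, rfl⟩
        · exact ⟨x, hb.below, by rw [hρs x (hne hb)]⟩
        · exact ⟨x, hx ▸ .refl _, by rw [hρ x hx, hx]⟩
      · rintro ⟨x, hx, rfl⟩
        refine ⟨(hsol _ _ _).2 ?_, _, _, _, rfl⟩
        rcases below_iff.1 hx with hx | hx
        · exact Or.inr ⟨hx.symm, hx.symm, hρ x hx.symm⟩
        · exact Or.inl ⟨hx, rfl, hρs x (hne hx)⟩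
  · cases hrow

/-- Any locally optimal choice of the values of the variables of `a` is possible in Phase 3. -/
theorem exists_isAnswerSet_value (hd : T.IsDFSForest M) (hG : HasValueFacts M T a s G)
    (hσ : ∀ x, M.owner x ≠ a → σ x = s x) (hopt : IsLocallyOptimal M T a σ) :
    ∃ S, IsAnswerSet (facts G ∪ valueRules M T a) S ∧
      valueAnswer S = {m | ∃ x, T.Below a (M.owner x) ∧ m = .solution (M.owner x) x (σ x)} := by
  classical
  have hne : ∀ {b}, T.Anc b a → b ≠ a := fun hb hba => hd.irrefl a (hba ▸ hb)
  let S : Set (Atom X F A V) := {m | m ∈ G ∨ m = .row (joinUtility M T a σ) (args (owned M a) σ) ∨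
    ∃ x, M.owner x = a ∧ m = .solution a x (σ x)}
  have hrow : ∀ U l, .row U l ∈ S ↔ U = joinUtility M T a σ ∧ l = args (owned M a) σ := by
    simp [S, hG.row]
  have hGS : ∀ m ∈ G, m ∈ S := fun m hm => Or.inl hm
  -- Received `solution` atoms have level 0, since they belong to proper ancestors; those of `a`
  -- depend on the row.
  refine ⟨S, isAnswerSet_of_level ?_ (fun m => match m with
    | .row _ _ => 1
    | .solution b _ _ => if b = a then 2 else 0
    | _ => 0) fun m hm => ?_, ?_⟩
  · intro r hr hb
    rcases mem_valueProgram_iff.1 hr with ⟨m', hm', rfl⟩ | ⟨σ', v, u, rfl⟩ | rfl |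
      ⟨σ', U, x, hx, rfl⟩
    · exact hGS _ hm'
    · exact ⟨bot_le, le_top⟩
    · refine hb _ rfl ?_
      have : {m | ∃ (U : WithBot ℝ) (σ : X → V), m = .row U (args (owned M a) σ)} ∩ S =
          {.row (joinUtility M T a σ) (args (owned M a) σ)} := by
        ext m
        constructor
        · rintro ⟨⟨U, σ', rfl⟩, hm⟩
          obtain ⟨rfl, h⟩ := (hrow _ _).1 hm
          rw [h]
          rfl
        · rintro rfl
          exact ⟨⟨_, _, rfl⟩, (hrow _ _).2 ⟨rfl, rfl⟩⟩
      rw [CardIn, this, Set.encard_singleton]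
      exact ⟨le_rfl, le_rfl⟩
    · have h := ((hrow _ _).1 (hb _ rfl)).2
      refine Or.inr (Or.inr ⟨x, mem_owned.1 hx, ?_⟩)
      rw [args_eq_args_iff.1 h x hx]
  · rcases hm with hm | rfl | ⟨x, hx, rfl⟩
    · exact ⟨_, mem_valueProgram_iff.2 (Or.inl ⟨m, hm, rfl⟩), Or.inl rfl, by simp⟩
    · refine ⟨_, mem_valueProgram_iff.2 (Or.inr (Or.inl
        ⟨σ, fun f => extUtility M f σ, fun c => optUtility M T c σ, rfl⟩)),
        Or.inr ⟨_, _, _, rfl, rfl⟩, fun S' hS' hl => ?_⟩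
      have hb := hG.joinBody_holds (σ := σ) (hopt.1 ▸ hopt.2)
      rintro b ((⟨x, hx, rfl⟩ | rfl) | hb')
      · have hxa := (mem_sep.1 hx).1
        refine hl _ (hGS _ ((hG.solution _ _ _).2 ⟨hxa, rfl, hσ x (hne hxa)⟩)) ?_
        simp [hne hxa]
      · have hself : IsEntry M T a (joinUtility M T a σ) (args (sep M T a) σ) :=
          isEntry_args.2 ⟨hopt.1, hopt.1 ▸ hopt.2⟩
        exact hl _ (hGS _ ((hG.table_self _ _).2 hself)) (by simp)
      · refine joinBody_redHolds ?_ S b hb'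
        rw [joinBody_holds_iff] at hb ⊢
        exact ⟨fun f hf => hl _ (hGS _ (hb.1 f hf)) (by simp),
          fun c hc => hl _ (hGS _ (hb.2 c hc)) (by simp)⟩
    · refine ⟨_, mem_valueProgram_iff.2 (Or.inr (Or.inr (Or.inr
        ⟨σ, joinUtility M T a σ, x, mem_owned.2 hx, rfl⟩))), Or.inl rfl, fun S' hS' hl => ?_⟩
      rintro b rfl
      exact hl _ ((hrow _ _).2 ⟨rfl, rfl⟩) (by simp)
  · ext m
    constructor
    · rintro ⟨hm | hm | ⟨x, hx, hm⟩, b, x, v, rfl⟩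
      · obtain ⟨hb, rfl, rfl⟩ := (hG.solution _ _ _).1 hm
        exact ⟨x, hb.below, by rw [hσ x (hne hb)]⟩
      · cases hm
      · cases hm
        exact ⟨x, hx ▸ .refl _, by rw [hx]⟩
    · rintro ⟨x, hx, rfl⟩
      refine ⟨?_, _, _, _, rfl⟩
      rcases below_iff.1 hx with hx | hx
      · exact Or.inr (Or.inr ⟨x, hx.symm, by rw [← hx]⟩)
      · exact hGS _ ((hG.solution _ _ _).2 ⟨hx, rfl, hσ x (hne hx)⟩)

end ASPDPOP

/-! ### Subtrees that are through do not change -/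

namespace TreeData

variable {X F A V : Type*} {M : DCOP X F A V} {T T' : TreeData A}

namespace IsSearch

variable [DecidableEq A] {root t a b : A} {W D : Finset A} {s : Finset A}

/-- The new agent hangs below the token, and the token is below no agent that is through. -/
theorem below_update_iff (h : T.IsSearch M root (some t) W D) (hb : b ∉ W)
    (hp : T'.parent = Function.update T.parent b (some t)) (ha : a ∈ D) {y : A} :
    T'.Below y a ↔ T.Below y a := by
  have hleaf : ∀ c, T.parent c ≠ some b := fun c hc => hb (h.mem_of_parent _ _ hc).2
  have hne : t ≠ b := fun htb => hb (htb ▸ h.token_mem _ rfl)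
  by_cases hy : y = b
  · subst hy
    have hya : y ≠ a := fun hya => hb (h.done_sub (hya ▸ ha))
    rw [below_iff, anc_update_self_iff hp hleaf hne]
    refine iff_of_false ?_ fun hya => hb (h.done_sub (h.mem_done_of_below ha hya))
    rintro (hya' | hta)
    · exact hya hya'
    · exact h.token_notMem (h.mem_done_of_below ha hta)
  · rw [below_iff, below_iff, anc_update_iff_of_ne hp hleaf hy]

theorem anc_update_iff (h : T.IsSearch M root (some t) W D) (hb : b ∉ W)
    (hp : T'.parent = Function.update T.parent b (some t)) (ha : a ∈ D) {y : A} :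
    T'.Anc y a ↔ T.Anc y a :=
  anc_update_iff_of_ne hp (fun _ hc => hb (h.mem_of_parent _ _ hc).2)
    fun hab => hb (h.done_sub (hab ▸ ha))

theorem children_update [Fintype A] (h : T.IsSearch M root (some t) W D) (hb : b ∉ W)
    (hp : T'.parent = Function.update T.parent b (some t)) (ha : a ∈ D) :
    T'.children a = T.children a := by
  ext c
  rw [mem_children, mem_children, hp]
  by_cases hc : c = b
  · subst hc
    rw [Function.update_self]
    refine iff_of_false ?_ fun hc => hb (h.mem_of_parent _ _ hc).1
    rintro hta
    obtain rfl := Option.some_injective _ hta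
    exact h.token_notMem ha
  · rw [Function.update_of_ne hc]

open ASPDPOP in
theorem sep_update [Fintype X] (h : T.IsSearch M root (some t) W D) (hb : b ∉ W)
    (hp : T'.parent = Function.update T.parent b (some t)) (ha : a ∈ D) :
    sep M T' a = sep M T a := by
  ext x
  simp only [mem_sep, h.anc_update_iff hb hp ha, h.below_update_iff hb hp ha]

open ASPDPOP in
theorem subConstraints_update [Fintype F] (h : T.IsSearch M root (some t) W D) (hb : b ∉ W)
    (hp : T'.parent = Function.update T.parent b (some t))
    (hq : T'.pseudo = Function.update T.pseudo b s) (ha : a ∈ D) :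
    subConstraints M T' a = subConstraints M T a := by
  ext f
  simp only [mem_subConstraints, h.below_update_iff hb hp ha]
  refine exists_congr fun y => and_congr_right fun hy => ?_
  have hyb : y ≠ b := fun hyb => hb (h.done_sub (h.mem_done_of_below ha (hyb ▸ hy)))
  simp only [related, hp, hq, Function.update_of_ne hyb, Finset.mem_filter]

end IsSearch

end TreeData

/-! ### Invariants of a run -/

namespace ASPDPOP

open ASP TreeData

variable {X F A V : Type*} [Fintype X] [Fintype F] {M : DCOP X F A V}

theorem IsLocallyOptimal.congr [Fintype A] {T : TreeData A} {a : A} {σ τ : X → V}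
    (hσ : IsLocallyOptimal M T a σ) (h : T.IsDFSForest M) (hs : ∀ x ∈ sep M T a, σ x = τ x)
    (ho : ∀ x, M.owner x = a → σ x = τ x) : IsLocallyOptimal M T a τ := by
  rw [IsLocallyOptimal, ← joinUtility_congr h hs ho, ← optUtility_congr hs]
  exact hσ

theorem exists_isLocallyOptimal [Fintype A] {T : TreeData A} {a : A} {s : X → V}
    (h : T.IsDFSForest M) (ho : optUtility M T a s ≠ ⊥) :
    ∃ σ, (∀ x, M.owner x ≠ a → σ x = s x) ∧ IsLocallyOptimal M T a σ := by
  classical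
  obtain ⟨τ, hτ, hτs⟩ := exists_joinUtility_eq h a s
  have hτo : IsLocallyOptimal M T a τ := by
    rw [IsLocallyOptimal, hτs, optUtility_congr hτ]
    exact ⟨rfl, ho⟩
  -- The optimum `τ` may differ from `s` at other agents. Resetting it there is harmless, as local
  -- optimality depends only on the variables of `a` and its separator.
  refine ⟨fun x => if M.owner x = a then τ x else s x, fun x hx => if_neg hx,
    hτo.congr h (fun x hx => ?_) fun x hx => (if_pos hx).symm⟩
  have hxa : M.owner x ≠ a := fun hxa => h.irrefl a (hxa ▸ (mem_sep.1 hx).1)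
  rw [if_neg hxa]
  exact hτ x hx

namespace Config

variable [Fintype A]

/-- The values sent so far in Phase 3 are those of `s`, and locally optimal. -/
def HasValues (M : DCOP X F A V) (c : Config X F A V) (s : X → V) : Prop :=
  ∀ a N, c.value a = some N →
    N = {m | ∃ x, c.tree.Below a (M.owner x) ∧ m = .solution (M.owner x) x (s x)} ∧
    IsLocallyOptimal M c.tree a s

theorem hasValues_of_none {c : Config X F A V} {s : X → V} (h : ∀ a, c.value a = none) :
    c.HasValues M s := fun a N hN => by
  rw [h a] at hN
  cases hN

variable [LinearOrder X] {root : A} {c c' : Config X F A V} {s σ : X → V}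

/-- The invariant of a run: the search, and the tables sent in Phase 2. -/
structure Invariant (M : DCOP X F A V) (root : A) (c : Config X F A V) : Prop where
  search : c.tree.IsSearch M root c.token c.visited c.finished
  finished_of_util : ∀ a, c.util a ≠ none → a ∈ c.finished
  util_child : ∀ a, c.util a ≠ none → ∀ b ∈ c.tree.children a, c.util b ≠ none
  isUtilMessage : ∀ a N, c.util a = some N → IsUtilMessage {a} N
  table : ∀ a N, c.util a = some N → ∀ U l, .tableMax a U l ∈ N ↔ IsEntry M c.tree a U l
  util_of_value : ∀ a, c.value a ≠ none → c.util a ≠ none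
  value_parent : ∀ a, c.value a ≠ none → ∀ p, c.tree.parent a = some p → c.value p ≠ none

namespace Invariant

theorem value_of_below (h : c.Invariant M root) {a b : A} (hab : c.tree.Below a b)
    (ha : c.value a ≠ none) : c.value b ≠ none := by
  induction hab with
  | refl => exact ha
  | tail _ hp ih => exact h.value_parent _ ih _ hp

/-- A VALUE message requires one from each ancestor, hence from the root. The root sends one only
after its UTIL message, thus after the search has ended. -/
theorem token_eq_none (h : c.Invariant M root) {a : A} (ha : c.value a ≠ none) :
    c.token = none := by
  have haW := h.search.done_sub (h.finished_of_util a (h.util_of_value a ha))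
  exact h.search.root_mem_done_iff.1 (h.finished_of_util _ (h.util_of_value _
    (h.value_of_below (h.search.below_root a haW) ha)))

theorem value_eq_none (h : c.Invariant M root) {t : A} (ht : c.token = some t) (a : A) :
    c.value a = none := by
  by_contra ha
  rw [h.token_eq_none ha] at ht
  cases ht

theorem isUtilMessage_receivedUtil (h : c.Invariant M root) (a : A) :
    IsUtilMessage (c.tree.children a) (c.receivedUtil a) := by
  rintro m ⟨b, hb, N, hN, hm⟩
  obtain ⟨b', hb', hm⟩ := h.isUtilMessage b N hN m hm
  obtain rfl := Finset.mem_singleton.1 hb'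
  exact ⟨b', hb, hm⟩

theorem table_receivedUtil (h : c.Invariant M root) {a b : A} (hb : b ∈ c.tree.children a)
    (hu : c.util b ≠ none) (U : WithBot ℝ) (l : List V) :
    .tableMax b U l ∈ c.receivedUtil a ↔ IsEntry M c.tree b U l := by
  constructor
  · rintro ⟨b', hb', N, hN, hm⟩
    obtain ⟨d, hd, hm'⟩ := h.isUtilMessage b' N hN _ hm
    obtain rfl := Finset.mem_singleton.1 hd
    obtain rfl : b = d := by
      rcases hm' with ⟨U, l, hm'⟩ | ⟨d, x, lb, ub, hm'⟩ <;> cases hm'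
      rfl
    exact (h.table b N hN U l).1 hm
  · intro hU
    obtain ⟨N, hN⟩ := Option.ne_none_iff_exists'.1 hu
    exact ⟨b, hb, N, hN, (h.table b N hN U l).2 hU⟩

theorem valueProgram_eq (M : DCOP X F A V) (c : Config X F A V) (a : A) :
    c.valueProgram M a = facts (spec M c.tree a ∪ c.storedUtil a ∪ c.receivedValue a ∪
      c.receivedUtil a) ∪ valueRules M c.tree a := by
  rw [valueProgram, facts_union, facts_union, facts_union]
  ext r
  simp only [Set.mem_union]
  tauto

theorem hasValueFacts (h : c.Invariant M root) (hs : c.HasValues M s) {a : A}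
    (hu : c.util a ≠ none) (hp : ∀ p, c.tree.parent a = some p → c.value p ≠ none) :
    HasValueFacts M c.tree a s (spec M c.tree a ∪ c.storedUtil a ∪ c.receivedValue a ∪
      c.receivedUtil a) := by
  have hd := h.search.toIsDFSForest
  have hstored : ∀ m ∈ c.storedUtil a, (∃ U l, m = .tableMax a U l) ∨
      ∃ d x lb ub, m = .tableInfo a d x lb ub := by
    rintro m ⟨N, hN, hm⟩
    obtain ⟨b, hb, hm⟩ := h.isUtilMessage a N hN m hm
    obtain rfl := Finset.mem_singleton.1 hb
    exact hm
  have hvalue : ∀ m, m ∈ c.receivedValue a ↔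
      ∃ x, c.tree.Anc (M.owner x) a ∧ m = .solution (M.owner x) x (s x) := by
    intro m
    constructor
    · rintro ⟨p, hp, N, hN, hm⟩
      rw [(hs p N hN).1] at hm
      obtain ⟨x, hx, rfl⟩ := hm
      exact ⟨x, anc_iff_parent.2 ⟨p, hp, hx⟩, rfl⟩
    · rintro ⟨x, hx, rfl⟩
      obtain ⟨p, hpa, hpx⟩ := anc_iff_parent.1 hx
      obtain ⟨N, hN⟩ := Option.ne_none_iff_exists'.1 (hp p hpa)
      refine ⟨p, hpa, N, hN, ?_⟩
      rw [(hs p N hN).1]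
      exact ⟨x, hpx, rfl⟩
  have hrecv := h.isUtilMessage_receivedUtil a
  refine ⟨⟨fun f hf u σ => ?_, fun b hb U l => ?_⟩, fun U l => ?_, fun U l => ?_,
    fun b x v => ?_⟩
  · refine Iff.trans ?_ ((util_mem_spec_iff (T := c.tree) (a := a)).trans
      (and_iff_right ((mem_related hd).1 hf).2))
    refine ⟨?_, fun hm => Or.inl (Or.inl (Or.inl hm))⟩
    rintro (((hm | hm) | hm) | hm)
    · exact hm
    · rcases hstored _ hm with ⟨U, l, hm⟩ | ⟨d, x, lb, ub, hm⟩ <;> cases hm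
    · obtain ⟨x, -, hm⟩ := (hvalue _).1 hm
      cases hm
    · obtain ⟨d, -, ⟨U, l, hm⟩ | ⟨d, x, lb, ub, hm⟩⟩ := hrecv _ hm <;> cases hm
  · rw [← h.table_receivedUtil hb (h.util_child a hu b hb)]
    refine ⟨?_, Or.inr⟩
    rintro (((hm | hm) | hm) | hm)
    · simp [spec, conFacts, varFacts] at hm
    · rcases hstored _ hm with ⟨U, l, hm⟩ | ⟨d, x, lb, ub, hm⟩ <;> cases hm
      exact (hd.irrefl a (anc_of_parent (mem_children.1 hb))).elim
    · obtain ⟨x, -, hm⟩ := (hvalue _).1 hm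
      cases hm
    · exact hm
  · obtain ⟨N, hN⟩ := Option.ne_none_iff_exists'.1 hu
    rw [← h.table a N hN]
    refine ⟨?_, fun hm => Or.inl (Or.inl (Or.inr ⟨N, hN, hm⟩))⟩
    rintro (((hm | hm) | hm) | hm)
    · simp [spec, conFacts, varFacts] at hm
    · obtain ⟨N', hN', hm⟩ := hm
      obtain rfl := Option.some_injective _ (hN.symm.trans hN')
      exact hm
    · obtain ⟨x, -, hm⟩ := (hvalue _).1 hm
      cases hm
    · obtain ⟨d, hd', ⟨U, l, hm⟩ | ⟨d, x, lb, ub, hm⟩⟩ := hrecv _ hm <;> cases hm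
      exact (hd.irrefl a (anc_of_parent (mem_children.1 hd'))).elim
  · rintro (((hm | hm) | hm) | hm)
    · simp [spec, conFacts, varFacts] at hm
    · rcases hstored _ hm with ⟨U, l, hm⟩ | ⟨d, x, lb, ub, hm⟩ <;> cases hm
    · obtain ⟨x, -, hm⟩ := (hvalue _).1 hm
      cases hm
    · obtain ⟨d, -, ⟨U, l, hm⟩ | ⟨d, x, lb, ub, hm⟩⟩ := hrecv _ hm <;> cases hm
  · constructor
    · rintro (((hm | hm) | hm) | hm)
      · simp [spec, conFacts, varFacts] at hm
      · rcases hstored _ hm with ⟨U, l, hm⟩ | ⟨d, x, lb, ub, hm⟩ <;> cases hm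
      · obtain ⟨x, hx, hm⟩ := (hvalue _).1 hm
        cases hm
        exact ⟨hx, rfl, rfl⟩
      · obtain ⟨d, -, ⟨U, l, hm⟩ | ⟨d, x, lb, ub, hm⟩⟩ := hrecv _ hm <;> cases hm
    · rintro ⟨hx, rfl, rfl⟩
      exact Or.inl (Or.inr ((hvalue _).2 ⟨x, hx, rfl⟩))

theorem initial (M : DCOP X F A V) (root : A) :
    Invariant M root (ASPDPOP.initial X F V root) where
  search := IsSearch.initial M root
  finished_of_util a h := (h rfl).elim
  util_child a h := (h rfl).elim
  isUtilMessage a N h := by cases h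
  table a N h := by cases h
  util_of_value a h := (h rfl).elim
  value_parent a h := (h rfl).elim

variable [DecidableEq A]

/-- Only variables of `a` change. An earlier sender has ancestors that have all sent, so `a` is not
among them, and its message and local optimality involve only variables at or above itself. -/
theorem hasValues_update (h : c.Invariant M root) (hs : c.HasValues M s) {a : A}
    {N : Set (Atom X F A V)} (hv : c.value a = none) (hσ : ∀ x, M.owner x ≠ a → σ x = s x)
    (hopt : IsLocallyOptimal M c.tree a σ)
    (hN : N = {m | ∃ x, c.tree.Below a (M.owner x) ∧ m = .solution (M.owner x) x (σ x)}) :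
    HasValues M { c with value := Function.update c.value a (some N) } σ := by
  intro b N' hN'
  by_cases hb : b = a
  · subst hb
    simp only [Function.update_self, Option.some.injEq] at hN'
    exact ⟨hN' ▸ hN, hopt⟩
  · simp only [Function.update_of_ne hb] at hN'
    have hbv : c.value b ≠ none := fun h0 => by simp [h0] at hN'
    have hx : ∀ x, c.tree.Below b (M.owner x) → s x = σ x := fun x hx =>
      (hσ x fun hxa => h.value_of_below hx hbv (hxa ▸ hv)).symm
    obtain ⟨hN', hopt'⟩ := hs b N' hN'
    refine ⟨?_, hopt'.congr h.search.toIsDFSForest (fun x hx' => hx x (mem_sep.1 hx').1.below)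
      fun x hxb => hx x (hxb ▸ .refl _)⟩
    rw [hN']
    ext m
    exact exists_congr fun x => and_congr_right fun hx' => by rw [hx x hx']

variable [LinearOrder V]

theorem step (h : c.Invariant M root) (hstep : Step M c c') : c'.Invariant M root := by
  cases hstep with
  | visit a b ht hab hb =>
    have hsearch := h.search
    rw [ht] at hsearch
    have hv := h.value_eq_none ht
    -- An agent that has sent its table is through, so the visit changes neither its separator nor
    -- the constraints of its subtree.
    have hsep : ∀ s, ∀ d ∈ c.finished, _ := fun s d hd => hsearch.sep_update
      (T' := { parent := Function.update c.tree.parent b (some a)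
               pseudo := Function.update c.tree.pseudo b s }) hb rfl hd
    have hsub : ∀ s, ∀ d ∈ c.finished, _ := fun s d hd => hsearch.subConstraints_update
      (T' := { parent := Function.update c.tree.parent b (some a)
               pseudo := Function.update c.tree.pseudo b s }) hb rfl rfl hd
    refine ⟨hsearch.visit_step hab hb rfl rfl fun d => by simp, h.finished_of_util,
      fun d hd e he => ?_, h.isUtilMessage, fun d N hN U l => ?_,
      h.util_of_value, fun d hd => (hd (hv d)).elim⟩
    · rw [hsearch.children_update hb rfl (h.finished_of_util d hd)] at he
      exact h.util_child d hd e he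
    · have hd : d ∈ c.finished := h.finished_of_util d fun h0 => by simp [h0] at hN
      rw [h.table d N hN U l, IsEntry, IsEntry, hsep _ d hd]
      simp only [optUtility_congr_tree (hsep _ d hd) (hsub _ d hd)]
  | back a ht hn =>
    have hsearch := h.search
    rw [ht] at hsearch
    exact ⟨hsearch.back_step hn, fun b hb => Finset.mem_insert_of_mem (h.finished_of_util b hb),
      h.util_child, h.isUtilMessage, h.table, h.util_of_value, h.value_parent⟩
  | util a S hf hu hc hS =>
    have hne : ∀ b, c.util b ≠ none →
        Function.update c.util a (some (utilAnswer a S)) b ≠ none := by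
      intro b hb
      by_cases hba : b = a
      · subst hba
        simp
      · rwa [Function.update_of_ne hba]
    refine ⟨h.search, fun b hb => ?_, fun b hb d hd => hne d ?_, fun b N hN => ?_,
      fun b N hN U l => ?_, fun b hb => hne b (h.util_of_value b hb), h.value_parent⟩
    · by_cases hba : b = a
      · exact hba ▸ hf
      · simp only [Function.update_of_ne hba] at hb
        exact h.finished_of_util b hb
    · by_cases hba : b = a
      · subst hba
        exact hc d hd
      · simp only [Function.update_of_ne hba] at hb
        exact h.util_child b hb d hd
    · by_cases hba : b = a
      · subst hba
        simp only [Function.update_self, Option.some.injEq] at hN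
        subst hN
        rintro m ⟨-, hm⟩
        refine ⟨b, Finset.mem_singleton_self b, hm⟩
      · simp only [Function.update_of_ne hba] at hN
        exact h.isUtilMessage b N hN
    · by_cases hba : b = a
      · subst hba
        simp only [Function.update_self, Option.some.injEq] at hN
        subst hN
        rw [← tableMax_mem_iff h.search.toIsDFSForest
          (fun b hb d => h.search.comparable_of_done hf hb) (h.isUtilMessage_receivedUtil b)
          (fun d hd => h.table_receivedUtil hd (hc d hd)) hS U l]
        exact ⟨fun hm => hm.1, fun hm => ⟨hm, Or.inl ⟨U, l, rfl⟩⟩⟩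
      · simp only [Function.update_of_ne hba] at hN
        exact h.table b N hN U l
  | value a S hu hv hp hS =>
    have hne : ∀ b, c.value b ≠ none →
        Function.update c.value a (some (valueAnswer S)) b ≠ none := by
      intro b hb
      by_cases hba : b = a
      · subst hba
        simp
      · rwa [Function.update_of_ne hba]
    refine ⟨h.search, h.finished_of_util, h.util_child, h.isUtilMessage, h.table,
      fun b hb => ?_, fun b hb p hbp => hne p ?_⟩
    · by_cases hba : b = a
      · exact hba ▸ hu
      · simp only [Function.update_of_ne hba] at hb
        exact h.util_of_value b hb
    · by_cases hba : b = a
      · subst hba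
        exact hp p hbp
      · simp only [Function.update_of_ne hba] at hb
        exact h.value_parent b hb p hbp

/-- The first alternative is needed because a substitution `X → V` need not exist at the start: `V`
may be empty. -/
theorem hasValues_step (h : c.Invariant M root)
    (hs : (∀ a, c.value a = none) ∨ ∃ s, c.HasValues M s) (hstep : Step M c c') :
    (∀ a, c'.value a = none) ∨ ∃ s, c'.HasValues M s := by
  cases hstep with
  | visit a b ht hab hb => exact Or.inl (h.value_eq_none ht)
  | back a ht hn => exact Or.inl (h.value_eq_none ht)
  | util a S hf hu hc hS => exact hs
  | value a S hu hv hp hS =>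
    rw [valueProgram_eq] at hS
    have hs' : ∃ s, c.HasValues M s := by
      rcases hs with hs | hs
      -- The row in the first VALUE answer set supplies a substitution, with which `HasValues` holds
      -- vacuously before the step.
      · obtain ⟨m, hm⟩ := exists_unique_row hS
        obtain ⟨U, σ, -⟩ := (hm.ge rfl : m ∈ _ ∩ S).1
        exact ⟨σ, hasValues_of_none hs⟩
      · exact hs
    obtain ⟨s, hs⟩ := hs'
    obtain ⟨σ, hσ, hopt, hN⟩ := exists_of_valueAnswerSet h.search.toIsDFSForest
      (h.hasValueFacts hs hu hp) hS
    exact Or.inr ⟨σ, h.hasValues_update hs hv hσ hopt hN⟩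

theorem of_reaches (hc : Reaches M (ASPDPOP.initial X F V root) c) :
    c.Invariant M root ∧ ((∀ a, c.value a = none) ∨ ∃ s, c.HasValues M s) := by
  induction hc with
  | refl => exact ⟨initial M root, Or.inl fun _ => rfl⟩
  | tail _ hstep ih => exact ⟨ih.1.step hstep, ih.1.hasValues_step ih.2 hstep⟩

end Invariant

end Config

end ASPDPOP

/-! ### Progress, soundness and completeness -/

namespace ASPDPOP

open ASP TreeData

namespace Config

variable {X F A V : Type*} [Fintype A] {M : DCOP X F A V}

open scoped Classical in
/-- The number of steps done so far. -/
noncomputable def progress (c : Config X F A V) : ℕ :=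
  c.visited.card + c.finished.card + (Finset.univ.filter fun a => c.util a ≠ none).card +
    (Finset.univ.filter fun a => c.value a ≠ none).card

theorem progress_le (c : Config X F A V) : c.progress ≤ 4 * Fintype.card A := by
  refine (Nat.add_le_add (Nat.add_le_add (Nat.add_le_add (Finset.card_le_univ _)
    (Finset.card_le_univ _)) (Finset.card_le_univ _)) (Finset.card_le_univ _)).trans ?_
  omega

variable [Fintype X] [Fintype F]

/-- The result of a complete run. -/
theorem HasValues.result {c : Config X F A V} {s : M.Assignment}
    (h : c.HasValues M fun x => s x) (hc : c.Complete) :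
    c.Result M s := by
  intro x v
  constructor
  · rintro ⟨N, hN, hm⟩
    rw [(h _ N hN).1] at hm
    obtain ⟨y, -, hy⟩ := hm
    obtain ⟨-, rfl, rfl⟩ := Atom.solution.inj hy
    rfl
  · rintro rfl
    obtain ⟨N, hN⟩ := Option.ne_none_iff_exists'.1 (hc (M.owner x))
    refine ⟨N, hN, ?_⟩
    rw [(h _ N hN).1]
    exact ⟨x, .refl _, rfl⟩

variable [LinearOrder X] {root : A} {c c' : Config X F A V} {s σ : X → V}

namespace Invariant

theorem isPseudoTree (h : c.Invariant M root) (hconn : M.graph.Connected)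
    (ht : c.token = none) : c.tree.IsPseudoTree M root := by
  have hsearch := h.search
  rw [ht] at hsearch
  exact hsearch.isPseudoTree hconn

/-- At the root the optimum is at least the total utility of `t`. Elsewhere it is a summand of the
finite sum that the parent has already realized. -/
theorem optUtility_ne_bot (h : c.Invariant M root) (hconn : M.graph.Connected)
    (hscope : ∀ f, (M.scope f).Nonempty) (hs : c.HasValues M s) (ht : c.token = none)
    {t : M.Assignment} (hfin : M.total t ≠ ⊥) {a : A}
    (hp : ∀ p, c.tree.parent a = some p → c.value p ≠ none) :
    optUtility M c.tree a s ≠ ⊥ := by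
  have hd := h.search.toIsDFSForest
  have htree := h.isPseudoTree hconn ht
  rcases hpa : c.tree.parent a with _ | p
  · have ha : a = root := by
      by_contra hne
      obtain ⟨p, hp, -⟩ := anc_iff_parent.1 (htree.2.2.1 a hne)
      rw [hpa] at hp
      cases hp
    subst ha
    have hle : subtreeUtility M c.tree a (fun x => t x) ≤ optUtility M c.tree a s :=
      subtreeUtility_le_optUtility fun x hx => by
        rw [sep_root htree.1] at hx
        exact (Finset.notMem_empty x hx).elim
    rw [subtreeUtility_root hd htree hscope, sum_extUtility] at hle
    exact fun h0 => hfin (le_bot_iff.1 (h0 ▸ hle))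
  · obtain ⟨N, hN⟩ := Option.ne_none_iff_exists'.1 (hp p hpa)
    obtain ⟨hj, ho⟩ := (hs p N hN).2
    rw [← hj] at ho
    exact (joinUtility_ne_bot_iff.1 ho).2 a (mem_children.2 hpa)

/-- Local optimality everywhere makes the values optimal at the root, whose separator is empty, so
every assignment competes there. -/
theorem sound (h : c.Invariant M root) (hconn : M.graph.Connected)
    (hscope : ∀ f, (M.scope f).Nonempty) (hvar : ∀ x, ∃ f, x ∈ M.scope f)
    (hs : c.HasValues M s) (hc : c.Complete) :
    ∃ s : M.Assignment, c.Result M s ∧ M.IsSolution s ∧ M.total s ≠ ⊥ := by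
  have hd := h.search.toIsDFSForest
  have htree := h.isPseudoTree hconn (h.token_eq_none (hc root))
  have hloc : ∀ a, IsLocallyOptimal M c.tree a s := fun a => by
    obtain ⟨N, hN⟩ := Option.ne_none_iff_exists'.1 (hc a)
    exact (hs a N hN).2
  have hroot := subtreeUtility_eq_optUtility hd (fun a => (hloc a).1) root
  have hne := (hloc root).2
  rw [← hroot, subtreeUtility_root hd htree hscope] at hne
  obtain ⟨s, rfl⟩ := exists_assignment hvar hne
  rw [sum_extUtility] at hne
  refine ⟨s, hs.result hc, fun t => ?_, hne⟩
  rw [← sum_extUtility, ← sum_extUtility s, ← subtreeUtility_root hd htree hscope,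
    ← subtreeUtility_root hd htree hscope, hroot]
  refine subtreeUtility_le_optUtility fun x hx => ?_
  rw [sep_root htree.1] at hx
  exact (Finset.notMem_empty x hx).elim

/-- The values of a solution of finite total utility are locally optimal. -/
theorem isLocallyOptimal_of_isSolution (h : c.Invariant M root) (hconn : M.graph.Connected)
    (hscope : ∀ f, (M.scope f).Nonempty) (hvar : ∀ x, ∃ f, x ∈ M.scope f) {s : M.Assignment}
    (hsol : M.IsSolution s) (hfin : M.total s ≠ ⊥) (ht : c.token = none) (a : A) :
    IsLocallyOptimal M c.tree a (fun x => s x) := by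
  have hd := h.search.toIsDFSForest
  have htree := h.isPseudoTree hconn ht
  have key : subtreeUtility M c.tree a (fun x => s x) = optUtility M c.tree a (fun x => s x) ∧
      subtreeUtility M c.tree a (fun x => s x) ≠ ⊥ := by
    have ha : c.tree.Below a root :=
      below_iff.2 ((em (a = root)).imp id fun hne => htree.2.2.1 a hne)
    refine Relation.ReflTransGen.head_induction_on (motive := fun a _ =>
      subtreeUtility M c.tree a (fun x => s x) = optUtility M c.tree a (fun x => s x) ∧
      subtreeUtility M c.tree a (fun x => s x) ≠ ⊥) ha ?_ ?_
    · have hs : subtreeUtility M c.tree root (fun x => s x) = M.total s := by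
        rw [subtreeUtility_root hd htree hscope, sum_extUtility]
      refine ⟨le_antisymm (subtreeUtility_le_optUtility fun _ _ => rfl) ?_, hs ▸ hfin⟩
      obtain ⟨τ, -, hτ⟩ := exists_subtreeUtility_eq M c.tree root (fun x => (s x : V))
      rw [← hτ, hs, subtreeUtility_root hd htree hscope]
      -- The competitor `τ` may leave the domains, but then its utility is `⊥`; otherwise it is an
      -- assignment and `hsol` applies.
      by_cases hτ : ∑ f, extUtility M f τ = ⊥
      · rw [hτ]
        exact bot_le
      · obtain ⟨t, rfl⟩ := exists_assignment hvar hτ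
        rw [sum_extUtility]
        exact hsol t
    · exact fun hpa _ ih => subtreeUtility_eq_optUtility_child hd ih.1 ih.2 hpa
  exact ⟨joinUtility_eq_optUtility hd key.1, key.1 ▸ key.2⟩

end Invariant

variable [DecidableEq A]

theorem card_filter_update_lt {β : Type*} {f : A → Option β} {a : A} {b : β} (ha : f a = none)
    {p : DecidablePred fun d => f d ≠ none}
    {q : DecidablePred fun d => Function.update f a (some b) d ≠ none} :
    (Finset.univ.filter fun d => f d ≠ none).card <
      (Finset.univ.filter fun d => Function.update f a (some b) d ≠ none).card := by
  refine Finset.card_lt_card ((Finset.ssubset_iff_of_subset fun d hd => ?_).2 ⟨a, ?_, ?_⟩)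
  · have hd := (Finset.mem_filter.1 hd).2
    have hda : d ≠ a := fun hda => hd (hda ▸ ha)
    simpa [Function.update_of_ne hda] using hd
  · simp
  · simp [ha]

variable [LinearOrder V]

namespace Invariant

theorem progress_lt (h : c.Invariant M root) (hstep : Step M c c') :
    c.progress < c'.progress := by
  unfold progress
  cases hstep with
  | visit a b ht hab hb =>
    have := Finset.card_insert_of_notMem hb
    dsimp only
    omega
  | back a ht hn =>
    have hsearch := h.search
    rw [ht] at hsearch
    have := Finset.card_insert_of_notMem hsearch.token_notMem
    dsimp only
    omega
  | util a S hf hu hc hS =>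
    exact Nat.add_lt_add_right (Nat.add_lt_add_left (card_filter_update_lt hu) _) _
  | value a S hu hv hp hS => exact Nat.add_lt_add_left (card_filter_update_lt hv) _

/-- As long as a run is not complete, it can be continued, provided that locally optimal values can
be chosen; the values may be chosen arbitrarily among these. -/
theorem exists_step (h : c.Invariant M root) (hconn : M.graph.Connected) (hs : c.HasValues M s)
    (hc : ¬ c.Complete) {Q : (X → V) → Prop} (hQ : Q s)
    (hopt : c.token = none → ∀ a, (∀ p, c.tree.parent a = some p → c.value p ≠ none) →
      ∃ σ, (∀ x, M.owner x ≠ a → σ x = s x) ∧ IsLocallyOptimal M c.tree a σ ∧ Q σ) :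
    ∃ c' σ, Step M c c' ∧ c'.HasValues M σ ∧ Q σ := by
  have hd := h.search.toIsDFSForest
  obtain ⟨r, hr⟩ := hd.rank
  rcases ht : c.token with _ | a
  · have hsearch := h.search
    rw [ht] at hsearch
    by_cases hu : ∀ a, c.util a ≠ none
    · obtain ⟨a₀, ha₀⟩ := not_forall.1 hc
      rw [not_not] at ha₀
      -- Smallest rank among those without a VALUE message: the parent has sent its own.
      obtain ⟨a, ha, hmin⟩ := Set.exists_min_image {a | c.value a = none} r (Set.toFinite _)
        ⟨a₀, ha₀⟩
      have hp : ∀ p, c.tree.parent a = some p → c.value p ≠ none := fun p hp hv =>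
        (hmin p hv).not_gt (hr a p hp)
      obtain ⟨σ, hσ, hloc, hQσ⟩ := hopt ht a hp
      obtain ⟨S, hS, hN⟩ := exists_isAnswerSet_value hd (h.hasValueFacts hs (hu a) hp) hσ hloc
      rw [← valueProgram_eq] at hS
      exact ⟨_, σ, Step.value c a S (hu a) ha hp hS, h.hasValues_update hs ha hσ hloc hN, hQσ⟩
    · obtain ⟨a₀, ha₀⟩ := not_forall.1 hu
      rw [not_not] at ha₀
      -- Largest rank among those without a UTIL message: all children have sent theirs.
      obtain ⟨a, ha, hmax⟩ := Set.exists_max_image {a | c.util a = none} r (Set.toFinite _)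
        ⟨a₀, ha₀⟩
      have hch : ∀ b ∈ c.tree.children a, c.util b ≠ none := fun b hb hv =>
        (hmax b hv).not_gt (hr b a (mem_children.1 hb))
      obtain ⟨S, hS⟩ := exists_isAnswerSet_util
        (fun ha => hd.irrefl a (anc_of_parent (mem_children.1 ha)))
        (h.isUtilMessage_receivedUtil a)
      exact ⟨_, s, Step.util c a S (hsearch.done_eq_univ hconn a) ha hch hS, hs, hQ⟩
  · have hv := h.value_eq_none ht
    by_cases hb : ∃ b, M.graph.Adj a b ∧ b ∉ c.visited
    · obtain ⟨b, hab, hb⟩ := hb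
      exact ⟨_, s, Step.visit c a b ht hab hb, hasValues_of_none hv, hQ⟩
    · push Not at hb
      exact ⟨_, s, Step.back c a ht hb, hasValues_of_none hv, hQ⟩

/-- Induction on the steps that can remain. The predicate `Q` pins the values to `s`, whose choice
is locally optimal at every agent. -/
theorem complete (h : c.Invariant M root) (hconn : M.graph.Connected)
    (hscope : ∀ f, (M.scope f).Nonempty) (hvar : ∀ x, ∃ f, x ∈ M.scope f) {s : M.Assignment}
    (hsol : M.IsSolution s) (hfin : M.total s ≠ ⊥) (hs : c.HasValues M fun x => s x) :
    ∃ c', Reaches M c c' ∧ c'.Complete ∧ c'.Result M s := by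
  induction hn : 4 * Fintype.card A - c.progress using Nat.strong_induction_on generalizing c with
  | _ n ih =>
    by_cases hc : c.Complete
    · exact ⟨c, .refl, hc, hs.result hc⟩
    · obtain ⟨c₁, σ, hstep, hs₁, rfl⟩ := h.exists_step hconn hs hc
        (Q := fun σ => σ = fun x => (s x : V)) rfl fun ht a _ => ⟨_, fun _ _ => rfl,
          h.isLocallyOptimal_of_isSolution hconn hscope hvar hsol hfin ht a, rfl⟩
      have h1 := h.progress_lt hstep
      have h2 := progress_le c₁
      obtain ⟨c', hr, hc'⟩ := ih _ (by omega) (h.step hstep) hs₁ rfl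
      exact ⟨c', hr.head hstep, hc'⟩

end Invariant

end Config

end ASPDPOP

/-! ### The proposition -/

open ASPDPOP in
theorem mainTheorem1 {X F A V : Type*} [Fintype X] [LinearOrder X] [Fintype F] [Fintype A]
    [DecidableEq A] [LinearOrder V] (M : DCOP X F A V) (hconn : M.graph.Connected)
    (hscope : ∀ f, (M.scope f).Nonempty) (hvar : ∀ x, ∃ f, x ∈ M.scope f) (root : A) :
    -- every run is finite
    (¬ ∃ run : ℕ → Config X F A V,
      run 0 = initial X F V root ∧ ∀ k, Config.Step M (run k) (run (k + 1))) ∧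
    -- the first phase generates a pseudo-tree
    (∀ c, Config.Reaches M (initial X F V root) c → c.token = none →
      c.tree.IsPseudoTree M root) ∧
    -- if some complete assignment has a finite total utility, no run gets stuck
    ((∃ t : M.Assignment, M.total t ≠ ⊥) →
      ∀ c, Config.Reaches M (initial X F V root) c → ¬ c.Complete → ∃ c', Config.Step M c c') ∧
    -- soundness
    (∀ c, Config.Reaches M (initial X F V root) c → c.Complete →
      ∃ s : M.Assignment, c.Result M s ∧ M.IsSolution s ∧ M.total s ≠ ⊥) ∧
    -- completeness, whatever pseudo-tree has been generated and whatever UTIL messages were sent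
    (∀ s : M.Assignment, M.IsSolution s → M.total s ≠ ⊥ →
      ∀ c, Config.Reaches M (initial X F V root) c → (∀ a, c.value a = none) →
        ∃ c', Config.Reaches M c c' ∧ c'.Complete ∧ c'.Result M s) := by
  refine ⟨?_, ?_, ?_, ?_, ?_⟩
  · rintro ⟨run, h0, hstep⟩
    have hinv : ∀ k, (run k).Invariant M root := by
      intro k
      induction k with
      | zero => exact h0 ▸ Config.Invariant.initial M root
      | succ k ih => exact ih.step (hstep k)
    have hle : ∀ k, k ≤ (run k).progress := by
      intro k
      induction k with
      | zero => exact Nat.zero_le _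
      | succ k ih => exact ih.trans_lt ((hinv k).progress_lt (hstep k))
    exact (Nat.lt_irrefl _) ((hle (4 * Fintype.card A + 1)).trans (Config.progress_le _))
  · exact fun c hc ht => (Config.Invariant.of_reaches hc).1.isPseudoTree hconn ht
  · rintro ⟨t, ht⟩ c hc hcomp
    obtain ⟨hinv, hs⟩ := Config.Invariant.of_reaches hc
    -- Before any VALUE message the assignment `t` serves as a substitution.
    obtain ⟨s, hs⟩ : ∃ s, c.HasValues M s := hs.elim
      (fun hs => ⟨fun x => t x, Config.hasValues_of_none hs⟩) id
    obtain ⟨c', σ, hstep, -⟩ := hinv.exists_step hconn hs hcomp (Q := fun _ => True) trivial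
      fun htok a hp => by
        obtain ⟨σ, hσ, hloc⟩ := exists_isLocallyOptimal hinv.search.toIsDFSForest
          (hinv.optUtility_ne_bot hconn hscope hs htok ht hp)
        exact ⟨σ, hσ, hloc, trivial⟩
    exact ⟨c', hstep⟩
  · intro c hc hcomp
    obtain ⟨hinv, hs | ⟨s, hs⟩⟩ := Config.Invariant.of_reaches hc
    · exact (hcomp root (hs root)).elim
    · exact hinv.sound hconn hscope hvar hs hcomp
  · exact fun s hsol hfin c hc hv => (Config.Invariant.of_reaches hc).1.complete hconn hscope hvar
      hsol hfin (Config.hasValues_of_none hv)
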